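/- Let $T>0$, $L>0$, and write $\Sigma=\{0,L\}\times(0,T)$, so that $L^2(\Sigma)=L^2(0,T)\times L^2(0,T)$. Let $H^1_{,0}(0,T)=\{v\in H^1(0,T):v(T)=0\}$ with the norm $\|\partial_t v\|_{L^2(0,T)}$, let $H^{1/2}_{,0}(0,T)=[H^1_{,0}(0,T),L^2(0,T)]_{1/2}$ with the Hilbert space interpolation norm $$\|f\|^2_{H^{1/2}_{,0}(0,T)}=\frac2\pi\int_0^\infty \tau^{-2}\inf_{v\in H^1_{,0}(0,T)}\Big(\|f-v\|^2_{L^2(0,T)}+\tau^2\|\partial_t v\|^2_{L^2(0,T)}\Big)\,d\tau ,$$ and let $H^{1/2}_{,0}(\Sigma)=H^{1/2}_{,0}(0,T)\times H^{1/2}_{,0}(0,T)$ with $\|(z_0,z_L)\|^2=\|z_0\|^2+\|z_L\|^2$. Its dual $[H^{1/2}_{,0}(\Sigma)]'$ carries the dual norm, and $\langle\cdot,\cdot\rangle_\Sigma$ denotes the duality pairing. For $w=(w_0,w_L)\in[H^{1/2}_{,0}(\Sigma)]'$ let $\partial_t^{-1}w_*\in L^2(0,T)$ be given by $\langle\partial_t^{-1}w_*,v\rangle_{L^2(0,T)}=\langle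 w_*,\int_{\cdot}^T v(s)\,ds\rangle$ for all $v\in L^2(0,T)$ (so $\partial_t^{-1}w_*(t)=\int_0^t w_*(s)\,ds$ if $w_*\in L^2(0,T)$), and let the single layer operator be $$Vw=\tfrac12\begin{pmatrix}\partial_t^{-1}w_0+(\partial_t^{-1}w_L)(\cdot-L)\\ (\partial_t^{-1}w_0)(\cdot-L)+\partial_t^{-1}w_L\end{pmatrix},$$ where functions on $(0,T)$ are extended by zero. Let the modified Hilbert transformation $\mathcal H_T:L^2(0,T)\to L^2(0,T)$ be $$\mathcal H_Tu(t)=\sum_{k=0}^\infty u_k\cos\Big(\big(\tfrac\pi2+k\pi\big)\tfrac tT\Big),\qquad u_k=\frac2T\int_0^Tu(t)\sin\Big(\big(\tfrac\pi2+k\pi\big)\tfrac tT\Big)dt ,$$ applied componentwise on $L^2(\Sigma)$. For $m\in\mathbb N_0$ let $C_m\in\mathbb R^{(m+1)\times(m+1)}$ be the zero matrix if $T\le L$, and if $T>L$ let $C_m=(c_{\ell i})_{\ell,i=0}^m$ with $c_{\ell i}=\sum_{k=0}^\infty b_{k\ell}b_{ki}$, where $$b_{kk}=2\Big(1-\frac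 LT\Big)\cos\Big(\big(\tfrac\pi2+k\pi\big)\frac LT\Big),$$ $$b_{k\ell}=\frac4\pi\,\frac{\sqrt{2k+1}\sqrt{2\ell+1}}{(k+\ell+1)(k-\ell)}\cos\Big((k+\ell+1)\frac\pi2\frac LT\Big)\sin\Big((\ell-k)\frac\pi2\frac LT\Big)$$ if $k-\ell$ is even and nonzero, and $b_{k\ell}=0$ if $k-\ell$ is odd. Let $\lambda_{\max}(C_m)$ be the maximal eigenvalue of $C_m$. Then the series defining $c_{\ell i}$ converge absolutely, $C_m$ is symmetric, $\lambda_{\max}(C_m)=0$ for all $m$ if $T\le L$, and $\sup_{m}\sqrt{\lambda_{\max}(C_m)}<\infty$. Moreover, for every $w\in[H^{1/2}_{,0}(\Sigma)]'$ one has $\mathcal H_TVw\in H^{1/2}_{,0}(\Sigma)$ and $$a_{\mathcal H_T}(w,w)=\langle\mathcal H_TVw,w\rangle_\Sigma\ \ge\ \frac12\Big(1-\frac12\sup_{m\in\mathbb N_0}\sqrt{\lambda_{\max}(C_m)}\Big)\,\|w\|^2_{[H^{1/2}_{,0}(\Sigma)]'} .$$ -/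

import Mathlib

open MeasureTheory Set

noncomputable section

namespace WaveBIE

/-! ### Sobolev spaces on the time interval `(0,T)` -/

/-- The real Hilbert space `L²(0,T)`. -/
abbrev L2 (T : ℝ) : Type := Lp ℝ 2 (volume.restrict (Ioo (0 : ℝ) T))

theorem integrableOn (T : ℝ) (g : L2 T) : IntegrableOn g (Ioo 0 T) :=
  (Lp.memLp g).integrable (by norm_num)

theorem intervalIntegrable {T : ℝ} (g : L2 T) {a b : ℝ} (ha : a ∈ Icc 0 T) (hb : b ∈ Icc 0 T) :
    IntervalIntegrable g volume a b := by
  have h : IntegrableOn g (Icc 0 T) := (integrableOn T g).congr_set_ae Ioo_ae_eq_Icc.symm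
  exact (h.mono_set (uIcc_subset_Icc ha hb)).intervalIntegrable

/-- `v` belongs to `H¹(0,T)` with weak derivative `g ∈ L²(0,T)` and satisfies `v(T) = 0`:
`v` has an absolutely continuous representative `V` on `[0,T]` with derivative `g`, and
`V(T) = 0`. -/
def IsH1Final (T : ℝ) (v g : L2 T) : Prop :=
  ∃ V : ℝ → ℝ, v =ᵐ[volume.restrict (Ioo 0 T)] V ∧
    (∀ t ∈ Icc 0 T, V t = V 0 + ∫ s in (0 : ℝ)..t, g s) ∧ V T = 0

theorem IsH1Final.add {T : ℝ} {v g v' g' : L2 T} (h : IsH1Final T v g) (h' : IsH1Final T v' g') :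
    IsH1Final T (v + v') (g + g') := by
  obtain ⟨V, hV, hd, h0⟩ := h
  obtain ⟨V', hV', hd', h0'⟩ := h'
  refine ⟨V + V', (Lp.coeFn_add v v').trans (hV.add hV'), fun t ht => ?_, by simp [h0, h0']⟩
  have hT : (0 : ℝ) ∈ Icc 0 T := ⟨le_rfl, ht.1.trans ht.2⟩
  have e : ∫ s in (0 : ℝ)..t, (g + g' : L2 T) s = ∫ s in (0 : ℝ)..t, (g s + g' s) := by
    rw [intervalIntegral.integral_of_le ht.1, intervalIntegral.integral_of_le ht.1,
      ← restrict_Ioo_eq_restrict_Ioc]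
    exact integral_congr_ae
      (ae_restrict_of_ae_restrict_of_subset (Ioo_subset_Ioo_right ht.2) (Lp.coeFn_add g g'))
  rw [e, intervalIntegral.integral_add (intervalIntegrable g hT ht) (intervalIntegrable g' hT ht)]
  simp only [Pi.add_apply]
  rw [hd t ht, hd' t ht]
  ring

theorem IsH1Final.smul {T : ℝ} {v g : L2 T} (c : ℝ) (h : IsH1Final T v g) :
    IsH1Final T (c • v) (c • g) := by
  obtain ⟨V, hV, hd, h0⟩ := h
  refine ⟨c • V, (Lp.coeFn_smul c v).trans (hV.const_smul c), fun t ht => ?_, by simp [h0]⟩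
  have e : ∫ s in (0 : ℝ)..t, (c • g : L2 T) s = ∫ s in (0 : ℝ)..t, c * g s := by
    rw [intervalIntegral.integral_of_le ht.1, intervalIntegral.integral_of_le ht.1,
      ← restrict_Ioo_eq_restrict_Ioc]
    exact integral_congr_ae
      (ae_restrict_of_ae_restrict_of_subset (Ioo_subset_Ioo_right ht.2) (Lp.coeFn_smul c g))
  rw [e, intervalIntegral.integral_const_mul]
  simp only [Pi.smul_apply, smul_eq_mul]
  rw [hd t ht]
  ring

theorem IsH1Final.zero (T : ℝ) : IsH1Final T 0 0 := by
  refine ⟨0, Lp.coeFn_zero _ _ _, fun t ht => ?_, rfl⟩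
  have e : ∫ s in (0 : ℝ)..t, (0 : L2 T) s = ∫ s in (0 : ℝ)..t, (0 : ℝ) := by
    rw [intervalIntegral.integral_of_le ht.1, intervalIntegral.integral_of_le ht.1,
      ← restrict_Ioo_eq_restrict_Ioc]
    exact integral_congr_ae
      (ae_restrict_of_ae_restrict_of_subset (Ioo_subset_Ioo_right ht.2) (Lp.coeFn_zero ℝ 2 _))
  rw [e]
  simp

/-- The Sobolev space `H¹_{,0}(0,T) = {v ∈ H¹(0,T) : v(T) = 0}`, given by the pairs `(v, ∂ₜv)`. -/
def H1Final (T : ℝ) : Submodule ℝ (L2 T × L2 T) where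
  carrier := {p | IsH1Final T p.1 p.2}
  add_mem' h h' := IsH1Final.add h h'
  zero_mem' := IsH1Final.zero T
  smul_mem' c _ h := IsH1Final.smul c h

/-! ### Interpolation -/

/-- The (quadratic) `K`-functional of the couple `(L²(0,T), H¹_{,0}(0,T))`, where `H¹_{,0}(0,T)` is
normed by `‖∂ₜv‖`:
`K(τ,f) = inf {(‖f - v‖² + τ² ‖∂ₜv‖²)^{1/2} : v ∈ H¹_{,0}(0,T)}`. -/
def kFun (T τ : ℝ) (f : L2 T) : ℝ :=
  ⨅ p : H1Final T, √(‖f - p.1.1‖ ^ 2 + τ ^ 2 * ‖p.1.2‖ ^ 2)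

theorem kFun_bddBelow (T τ : ℝ) (f : L2 T) :
    BddBelow (range fun p : H1Final T => √(‖f - p.1.1‖ ^ 2 + τ ^ 2 * ‖p.1.2‖ ^ 2)) :=
  ⟨0, by rintro _ ⟨p, rfl⟩; positivity⟩

theorem kFun_nonneg (T τ : ℝ) (f : L2 T) : 0 ≤ kFun T τ f :=
  Real.iInf_nonneg fun _ => Real.sqrt_nonneg _

theorem kFun_le (T τ : ℝ) (f : L2 T) (p : H1Final T) :
    kFun T τ f ≤ √(‖f - p.1.1‖ ^ 2 + τ ^ 2 * ‖p.1.2‖ ^ 2) :=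
  ciInf_le (kFun_bddBelow T τ f) p

theorem kFun_measurable (T : ℝ) (f : L2 T) : Measurable fun τ => kFun T τ f := by
  have h : Monotone fun τ => kFun T (max τ 0) f := by
    intro a b hab
    refine ciInf_mono (kFun_bddBelow T _ f) fun p => ?_
    have : max a 0 ≤ max b 0 := max_le_max_right 0 hab
    have h0 : 0 ≤ max a 0 := le_max_right _ _
    gcongr
  have e : (fun τ => kFun T τ f) = (fun τ => kFun T (max τ 0) f) ∘ fun τ => |τ| := by
    funext τ
    simp [kFun]
  rw [e]
  exact h.measurable.comp continuous_abs.measurable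

theorem sqrt_add_le {a b c d : ℝ} : √((a + b) ^ 2 + (c + d) ^ 2) ≤
    √(a ^ 2 + c ^ 2) + √(b ^ 2 + d ^ 2) := by
  have h1 := Real.sq_sqrt (by positivity : 0 ≤ a ^ 2 + c ^ 2)
  have h2 := Real.sq_sqrt (by positivity : 0 ≤ b ^ 2 + d ^ 2)
  have h3 : a * b + c * d ≤ √(a ^ 2 + c ^ 2) * √(b ^ 2 + d ^ 2) := by
    rw [← Real.sqrt_mul (by positivity)]
    apply Real.le_sqrt_of_sq_le
    nlinarith [sq_nonneg (a * d - b * c)]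
  apply Real.sqrt_le_iff.2
  constructor
  · positivity
  · nlinarith

theorem kFun_add (T τ : ℝ) (f f' : L2 T) : kFun T τ (f + f') ≤ kFun T τ f + kFun T τ f' := by
  refine le_ciInf_add_ciInf fun p q => (kFun_le T τ _ (p + q)).trans ?_
  have e1 : ‖f + f' - (p + q : H1Final T).1.1‖ ≤ ‖f - p.1.1‖ + ‖f' - q.1.1‖ := by
    refine le_trans (le_of_eq ?_) (norm_add_le _ _)
    congr 1
    simp only [Submodule.coe_add, Prod.fst_add]
    abel
  have e2 : ‖(p + q : H1Final T).1.2‖ ≤ ‖p.1.2‖ + ‖q.1.2‖ := norm_add_le _ _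
  have h := sqrt_add_le (a := ‖f - p.1.1‖) (b := ‖f' - q.1.1‖) (c := |τ| * ‖p.1.2‖)
    (d := |τ| * ‖q.1.2‖)
  rw [← mul_add, mul_pow, mul_pow, mul_pow, sq_abs] at h
  refine le_trans ?_ h
  gcongr

theorem kFun_smul_le (T τ c : ℝ) (f : L2 T) : kFun T τ (c • f) ≤ |c| * kFun T τ f := by
  unfold kFun
  rw [Real.mul_iInf_of_nonneg (abs_nonneg c)]
  refine le_ciInf fun p => (kFun_le T τ _ (c • p)).trans (le_of_eq ?_)
  have e1 : ‖c • f - (c • p : H1Final T).1.1‖ = |c| * ‖f - p.1.1‖ := by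
    rw [← Real.norm_eq_abs, ← norm_smul, smul_sub]; rfl
  have e2 : ‖(c • p : H1Final T).1.2‖ = |c| * ‖p.1.2‖ := by
    rw [← Real.norm_eq_abs, ← norm_smul]; rfl
  rw [e1, e2, ← Real.sqrt_sq (abs_nonneg c), ← Real.sqrt_mul (by positivity)]
  congr 1
  rw [Real.sqrt_sq (abs_nonneg c)]
  ring

theorem kFun_smul (T τ c : ℝ) (f : L2 T) : kFun T τ (c • f) = |c| * kFun T τ f := by
  refine le_antisymm (kFun_smul_le T τ c f) ?_
  rcases eq_or_ne c 0 with rfl | hc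
  · simpa using kFun_nonneg T τ ((0 : ℝ) • f)
  · have h := kFun_smul_le T τ c⁻¹ (c • f)
    rw [smul_smul, inv_mul_cancel₀ hc, one_smul, abs_inv] at h
    rwa [le_inv_mul_iff₀ (abs_pos.2 hc)] at h

theorem kFun_zero (T τ : ℝ) : kFun T τ 0 = 0 := by
  simpa using kFun_smul T τ 0 0

/-- The interpolation space `H^{1/2}_{,0}(0,T) = [H¹_{,0}(0,T), L²(0,T)]_{1/2}` as a subspace of
`L²(0,T)`: all `f` with `∫₀^∞ τ⁻² K(τ,f)² dτ < ∞`. -/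
def hHalfSubmodule (T : ℝ) : Submodule ℝ (L2 T) where
  carrier := {f | MemLp (fun τ => kFun T τ f / τ) 2 (volume.restrict (Ioi 0))}
  add_mem' {f f'} h h' := by
    refine (MemLp.add h h').mono
      ((kFun_measurable T _).div measurable_id).aestronglyMeasurable
      (Filter.Eventually.of_forall fun τ => ?_)
    simp only [Pi.add_apply, ← add_div, norm_div, Real.norm_eq_abs]
    rw [abs_of_nonneg (kFun_nonneg _ _ _),
      abs_of_nonneg (add_nonneg (kFun_nonneg _ _ _) (kFun_nonneg _ _ _))]
    gcongr
    exact kFun_add T τ f f'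
  zero_mem' := by
    simp only [mem_ofPred_eq, kFun_zero, zero_div]
    exact MemLp.zero'
  smul_mem' c f h := by
    simp only [mem_ofPred_eq, kFun_smul, mul_div_assoc] at h ⊢
    exact h.const_mul _

/-- The space `H^{1/2}_{,0}(0,T)`, as a type with its own (interpolation) norm. -/
def HHalf (T : ℝ) : Type := hHalfSubmodule T

instance (T : ℝ) : AddCommGroup (HHalf T) := inferInstanceAs (AddCommGroup (hHalfSubmodule T))

instance (T : ℝ) : Module ℝ (HHalf T) := inferInstanceAs (Module ℝ (hHalfSubmodule T))

/-- An element of `L²(0,T)` that belongs to `H^{1/2}_{,0}(0,T)`, as an element of that space. -/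
def HHalf.mk {T : ℝ} (f : L2 T) (hf : f ∈ hHalfSubmodule T) : HHalf T :=
  (⟨f, hf⟩ : hHalfSubmodule T)

/-- The embedding of `H^{1/2}_{,0}(0,T)` into `L²(0,T)`. -/
def HHalf.val {T : ℝ} (f : HHalf T) : L2 T := Subtype.val (p := (· ∈ hHalfSubmodule T)) f

theorem HHalf.memLp {T : ℝ} (f : HHalf T) :
    MemLp (fun τ => kFun T τ f.val / τ) 2 (volume.restrict (Ioi 0)) :=
  Subtype.property (p := (· ∈ hHalfSubmodule T)) f

theorem HHalf.val_add {T : ℝ} (f f' : HHalf T) : (f + f').val = f.val + f'.val := rfl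

theorem HHalf.val_smul {T : ℝ} (c : ℝ) (f : HHalf T) : (c • f).val = c • f.val := rfl

/-- The interpolation norm `‖f‖ = ((2/π) ∫₀^∞ τ⁻² K(τ,f)² dτ)^{1/2}`. The factor `2/π` is the usual
normalization for which the interpolation of Hilbert spaces is exact; with it
`‖f‖² = ∑ₖ (T/2) ωₖ fₖ²` for `f = ∑ₖ fₖ cos (ωₖ t)`, `ωₖ = (π/2 + kπ)/T`. -/
instance (T : ℝ) : Norm (HHalf T) :=
  ⟨fun f => √(2 / Real.pi) *
    (eLpNorm (fun τ => kFun T τ f.val / τ) 2 (volume.restrict (Ioi 0))).toReal⟩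

theorem HHalf.norm_def {T : ℝ} (f : HHalf T) : ‖f‖ = √(2 / Real.pi) *
    (eLpNorm (fun τ => kFun T τ f.val / τ) 2 (volume.restrict (Ioi 0))).toReal := rfl

/-! ### Inverses of the time derivative -/

/-- The function `t ↦ - ∫_t^T g(s) ds`. -/
def primFun (T : ℝ) (g : L2 T) (t : ℝ) : ℝ := -∫ s in t..T, g s

theorem primFun_eq {T : ℝ} (g : L2 T) {t : ℝ} (ht : t ∈ Icc 0 T) :
    primFun T g t = primFun T g 0 + ∫ s in (0 : ℝ)..t, g s := by
  have hT : (0 : ℝ) ≤ T := ht.1.trans ht.2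
  have h := intervalIntegral.integral_add_adjacent_intervals
    (intervalIntegrable g ⟨le_rfl, hT⟩ ht) (intervalIntegrable g ht ⟨hT, le_rfl⟩)
  unfold primFun
  rw [← h]
  ring

theorem abs_primFun_le {T : ℝ} (g : L2 T) {t : ℝ} (ht : t ∈ Icc 0 T) :
    ‖primFun T g t‖ ≤ √T * ‖g‖ := by
  have hT : (0 : ℝ) ≤ T := ht.1.trans ht.2
  have h1 : ‖primFun T g t‖ ≤ ∫ s in Ioo 0 T, ‖g s‖ := by
    unfold primFun
    rw [norm_neg, intervalIntegral.integral_of_le ht.2, ← restrict_Ioo_eq_restrict_Ioc]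
    refine (norm_integral_le_integral_norm _).trans ?_
    exact setIntegral_mono_set (integrableOn T g).norm (Filter.Eventually.of_forall fun _ =>
      norm_nonneg _) (Ioo_subset_Ioo_left ht.1).eventuallyLE
  refine h1.trans ?_
  have h2 := eLpNorm_le_eLpNorm_mul_rpow_measure_univ (p := 1) (q := 2)
    (μ := volume.restrict (Ioo (0 : ℝ) T)) (by norm_num) (Lp.aestronglyMeasurable g)
  rw [Measure.restrict_apply_univ, Real.volume_Ioo, sub_zero] at h2
  have h3 := ENNReal.toReal_mono (ENNReal.mul_ne_top (Lp.eLpNorm_ne_top g)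
    (ENNReal.rpow_ne_top_of_nonneg (by norm_num) ENNReal.ofReal_ne_top)) h2
  rw [ENNReal.toReal_mul, ← ENNReal.toReal_rpow, ENNReal.toReal_ofReal hT, ← Lp.norm_def,
    eLpNorm_one_eq_lintegral_enorm,
    ← integral_norm_eq_lintegral_enorm (Lp.aestronglyMeasurable g)] at h3
  refine h3.trans (le_of_eq ?_)
  rw [mul_comm, Real.sqrt_eq_rpow]
  norm_num

theorem primFun_memLp (T : ℝ) (g : L2 T) :
    MemLp (primFun T g) 2 (volume.restrict (Ioo 0 T)) := by
  refine MemLp.of_bound ?_ (√T * ‖g‖) ?_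
  · have hc : ContinuousOn (primFun T g) (Icc 0 T) := by
      rcases le_or_gt 0 T with hT | hT
      · have hi : IntegrableOn g (uIcc 0 T) := by
          rw [uIcc_of_le hT]
          exact (integrableOn T g).congr_set_ae Ioo_ae_eq_Icc.symm
        have h := intervalIntegral.continuousOn_primitive_interval hi
        rw [uIcc_of_le hT] at h
        exact (continuousOn_const.add h).congr fun t ht => primFun_eq g ht
      · simp [Icc_eq_empty_of_lt hT]
    exact (hc.mono Ioo_subset_Icc_self).aestronglyMeasurable measurableSet_Ioo
  · filter_upwards [ae_restrict_mem measurableSet_Ioo] with t ht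
    exact abs_primFun_le g (Ioo_subset_Icc_self ht)

/-- `- ∫_t^T g(s) ds` as an element of `L²(0,T)`. -/
def prim (T : ℝ) (g : L2 T) : L2 T := (primFun_memLp T g).toLp

theorem prim_isH1Final (T : ℝ) (g : L2 T) : IsH1Final T (prim T g) g :=
  ⟨primFun T g, (primFun_memLp T g).coeFn_toLp, fun _ ht => primFun_eq g ht, by simp [primFun]⟩

theorem IsH1Final.eq_prim {T : ℝ} {v g : L2 T} (h : IsH1Final T v g) : v = prim T g := by
  obtain ⟨V, hV, hd, h0⟩ := h
  refine Lp.ext ?_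
  filter_upwards [hV, (primFun_memLp T g).coeFn_toLp, ae_restrict_mem measurableSet_Ioo]
    with t h1 h2 ht
  have hT : T ∈ Icc 0 T := ⟨ht.1.le.trans ht.2.le, le_rfl⟩
  have a1 := hd t (Ioo_subset_Icc_self ht)
  have a2 := hd T hT
  have a3 := primFun_eq g (Ioo_subset_Icc_self ht)
  have a4 := primFun_eq g hT
  have a5 : primFun T g T = 0 := by simp [primFun]
  rw [h1, prim, h2]
  linarith

theorem norm_prim_le (T : ℝ) (g : L2 T) : ‖prim T g‖ ≤ |T| * ‖g‖ := by
  rcases le_or_gt 0 T with hT | hT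
  · have h := Lp.norm_le_of_ae_bound (f := prim T g) (C := √T * ‖g‖) (by positivity) (by
      filter_upwards [(primFun_memLp T g).coeFn_toLp, ae_restrict_mem measurableSet_Ioo]
        with t h2 ht
      rw [prim, h2]
      exact abs_primFun_le g (Ioo_subset_Icc_self ht))
    refine h.trans (le_of_eq ?_)
    have e : ((measureUnivNNReal (volume.restrict (Ioo (0 : ℝ) T)) : NNReal) : ℝ) = T := by
      simp only [measureUnivNNReal, Measure.restrict_apply_univ, Real.volume_Ioo, sub_zero]
      exact ENNReal.toReal_ofReal hT
    rw [e, abs_of_nonneg hT]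
    have : T ^ ((2 : ENNReal).toReal)⁻¹ = √T := by
      rw [Real.sqrt_eq_rpow]; norm_num
    rw [this, ← mul_assoc, Real.mul_self_sqrt hT]
  · have : prim T g = 0 := by
      refine Lp.ext ?_
      filter_upwards [ae_restrict_mem measurableSet_Ioo] with t ht
      exact absurd (ht.1.trans ht.2) (not_lt.2 hT.le)
    rw [this, norm_zero]
    positivity

theorem HHalf.core (T : ℝ) : NormedSpace.Core ℝ (HHalf T) where
  norm_nonneg f := by rw [HHalf.norm_def]; positivity
  norm_smul c f := by
    have e : (fun τ => kFun T τ (c • f).val / τ) = |c| • fun τ => kFun T τ f.val / τ := by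
      funext τ
      rw [HHalf.val_smul, kFun_smul]
      simp [mul_div_assoc]
    rw [HHalf.norm_def, HHalf.norm_def, e, eLpNorm_const_smul, ENNReal.toReal_mul]
    simp
    ring
  norm_triangle f f' := by
    rw [HHalf.norm_def, HHalf.norm_def, HHalf.norm_def, ← mul_add]
    refine mul_le_mul_of_nonneg_left ?_ (Real.sqrt_nonneg _)
    rw [← ENNReal.toReal_add f.memLp.eLpNorm_ne_top f'.memLp.eLpNorm_ne_top]
    refine ENNReal.toReal_mono
      (ENNReal.add_ne_top.2 ⟨f.memLp.eLpNorm_ne_top, f'.memLp.eLpNorm_ne_top⟩) ?_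
    refine le_trans (eLpNorm_mono_real (g := fun τ => ‖kFun T τ f.val / τ + kFun T τ f'.val / τ‖)
      fun τ => ?_) (le_trans (le_of_eq (eLpNorm_norm _))
      (eLpNorm_add_le f.memLp.1 f'.memLp.1 (by norm_num)))
    rw [HHalf.val_add, ← add_div, norm_div, norm_div, Real.norm_of_nonneg (kFun_nonneg _ _ _),
      Real.norm_of_nonneg (add_nonneg (kFun_nonneg _ _ _) (kFun_nonneg _ _ _))]
    gcongr
    exact kFun_add T τ _ _
  norm_eq_zero_iff f := by
    constructor
    · intro h
      rw [HHalf.norm_def, mul_eq_zero_iff_left (by positivity), ENNReal.toReal_eq_zero_iff,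
        or_iff_left f.memLp.eLpNorm_ne_top, eLpNorm_eq_zero_iff f.memLp.1 (by norm_num)] at h
      have hne : (volume.restrict (Ioi (0 : ℝ))) ≠ 0 := by simp
      have : NeZero (volume.restrict (Ioi (0 : ℝ))) := ⟨hne⟩
      obtain ⟨τ, h1, h2⟩ := (h.and (ae_restrict_mem measurableSet_Ioi)).exists
      have hτ : 0 < τ := h2
      have hk : kFun T τ f.val = 0 := by
        simpa [hτ.ne'] using h1
      have hf : f.val = 0 := by
        rw [← norm_le_zero_iff]
        refine le_of_forall_pos_le_add fun ε hε => ?_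
        set C : ℝ := 1 + |T| / τ with hC
        have hC0 : 0 < C := by positivity
        have hlt : kFun T τ f.val < ε / C := by rw [hk]; positivity
        obtain ⟨p, hp⟩ := exists_lt_of_ciInf_lt hlt
        have p1 : ‖f.val - p.1.1‖ ≤ ε / C := by
          refine le_trans (Real.le_sqrt_of_sq_le ?_) hp.le
          nlinarith [sq_nonneg (τ * ‖p.1.2‖)]
        have p2 : τ * ‖p.1.2‖ ≤ ε / C := by
          refine le_trans (Real.le_sqrt_of_sq_le ?_) hp.le
          nlinarith [sq_nonneg ‖f.val - p.1.1‖]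
        have p3 : ‖p.1.1‖ ≤ |T| * ‖p.1.2‖ := by
          have := IsH1Final.eq_prim p.2
          rw [this]
          exact norm_prim_le T _
        have p4 : ‖f.val‖ ≤ ‖f.val - p.1.1‖ + ‖p.1.1‖ := by
          simpa using norm_add_le (f.val - p.1.1) p.1.1
        have p5 : ‖p.1.2‖ ≤ ε / C / τ := by rwa [le_div_iff₀ hτ, mul_comm]
        have p6 : |T| * ‖p.1.2‖ ≤ |T| * (ε / C / τ) := by gcongr
        have p7 : ε / C + |T| * (ε / C / τ) = ε := by
          rw [hC] at hC0 ⊢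
          field_simp
        linarith
      exact Subtype.ext hf
    · rintro rfl
      have : (0 : HHalf T).val = 0 := rfl
      rw [HHalf.norm_def, this]
      simp [kFun_zero]

instance (T : ℝ) : NormedAddCommGroup (HHalf T) := NormedAddCommGroup.ofCore (HHalf.core T)

instance (T : ℝ) : NormedSpace ℝ (HHalf T) := NormedSpace.ofCore (HHalf.core T)

theorem norm_kFun_prim_le {T τ : ℝ} (hτ : 0 < τ) (g : L2 T) :
    ‖kFun T τ (prim T g) / τ‖ ≤ ‖g‖ * (if τ ≤ 1 then 1 else |T| / τ) := by
  rw [Real.norm_of_nonneg (div_nonneg (kFun_nonneg _ _ _) hτ.le)]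
  split_ifs
  · have h := kFun_le T τ (prim T g) ⟨(prim T g, g), prim_isH1Final T g⟩
    have e : √(‖prim T g - prim T g‖ ^ 2 + τ ^ 2 * ‖g‖ ^ 2) = τ * ‖g‖ := by
      rw [sub_self, norm_zero, ← mul_pow, zero_pow two_ne_zero, zero_add,
        Real.sqrt_sq (by positivity)]
    rw [mul_one, div_le_iff₀ hτ, mul_comm]
    exact h.trans e.le
  · have h := kFun_le T τ (prim T g) 0
    have e : √(‖prim T g - (0 : L2 T)‖ ^ 2 + τ ^ 2 * ‖(0 : L2 T)‖ ^ 2) = ‖prim T g‖ := by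
      rw [sub_zero, norm_zero, zero_pow two_ne_zero, mul_zero, add_zero,
        Real.sqrt_sq (norm_nonneg _)]
    rw [mul_div_assoc', div_le_div_iff_of_pos_right hτ, mul_comm]
    exact (h.trans e.le).trans (norm_prim_le T g)

theorem memLp_bound (T : ℝ) :
    MemLp (fun τ : ℝ => if τ ≤ 1 then (1 : ℝ) else |T| / τ) 2 (volume.restrict (Ioi 0)) := by
  have hm : Measurable (fun τ : ℝ => if τ ≤ 1 then (1 : ℝ) else |T| / τ) :=
    Measurable.ite measurableSet_Iic measurable_const (measurable_const.div measurable_id)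
  rw [memLp_two_iff_integrable_sq hm.aestronglyMeasurable]
  have hu : Ioi (0 : ℝ) = Ioc 0 1 ∪ Ioi 1 := (Ioc_union_Ioi_eq_Ioi zero_le_one).symm
  change IntegrableOn _ (Ioi 0) volume
  rw [hu]
  refine IntegrableOn.union ?_ ?_
  · refine (integrableOn_const (C := (1 : ℝ)) (by simp)).congr_fun (fun τ hτ => ?_)
      measurableSet_Ioc
    simp [hτ.2]
  · have h := (integrableOn_Ioi_rpow_of_lt (a := -2) (by norm_num) zero_lt_one).const_mul (T ^ 2)
    refine IntegrableOn.congr_fun h (fun τ hτ => ?_) measurableSet_Ioi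
    have h1 : (1 : ℝ) < τ := hτ
    have h0 : (0 : ℝ) < τ := zero_lt_one.trans h1
    simp only [not_le.2 h1, if_false]
    rw [Real.rpow_neg h0.le, div_pow, sq_abs, div_eq_mul_inv]
    norm_num

theorem prim_mem (T : ℝ) (g : L2 T) : prim T g ∈ hHalfSubmodule T := by
  refine ((memLp_bound T).const_mul ‖g‖).mono
    ((kFun_measurable T _).div measurable_id).aestronglyMeasurable ?_
  filter_upwards [ae_restrict_mem measurableSet_Ioi] with τ hτ
  exact (norm_kFun_prim_le hτ g).trans (le_abs_self _)

/-- The inverse `g ↦ - ∫_t^T g(s) ds` of `∂ₜ : H¹_{,0}(0,T) → L²(0,T)`, as a bounded operator from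
`L²(0,T)` to `H^{1/2}_{,0}(0,T)`. -/
def dtBarInv (T : ℝ) : L2 T →L[ℝ] HHalf T :=
  LinearMap.mkContinuous
    { toFun := fun g => HHalf.mk (prim T g) (prim_mem T g)
      map_add' := fun g g' => Subtype.ext
        (((prim_isH1Final T g).add (prim_isH1Final T g')).eq_prim).symm
      map_smul' := fun c g => Subtype.ext (((prim_isH1Final T g).smul c).eq_prim).symm }
    (√(2 / Real.pi) * (eLpNorm (fun τ : ℝ => if τ ≤ 1 then (1 : ℝ) else |T| / τ) 2
      (volume.restrict (Ioi 0))).toReal)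
    (fun g => by
      change ‖HHalf.mk (prim T g) (prim_mem T g)‖ ≤ _
      rw [HHalf.norm_def, mul_assoc]
      refine mul_le_mul_of_nonneg_left ?_ (Real.sqrt_nonneg _)
      have e : (eLpNorm (fun τ : ℝ => if τ ≤ 1 then (1 : ℝ) else |T| / τ) 2
          (volume.restrict (Ioi 0))).toReal * ‖g‖ =
          (eLpNorm (‖g‖ • fun τ : ℝ => if τ ≤ 1 then (1 : ℝ) else |T| / τ) 2
            (volume.restrict (Ioi 0))).toReal := by
        rw [eLpNorm_const_smul, ENNReal.toReal_mul, mul_comm]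
        simp
      rw [e]
      refine ENNReal.toReal_mono ((memLp_bound T).const_smul ‖g‖).eLpNorm_ne_top
        (eLpNorm_mono_ae ?_)
      filter_upwards [ae_restrict_mem measurableSet_Ioi] with τ hτ
      exact (norm_kFun_prim_le hτ g).trans (le_abs_self _))

/-- The operator `∂ₜ⁻¹` on the dual space `[H^{1/2}_{,0}(0,T)]'`, with values in `L²(0,T)`, defined
by duality: `⟨∂ₜ⁻¹ w, v⟩ = ⟨w, ∫_·^T v(s) ds⟩` for all `v ∈ L²(0,T)`. By Fubini's theorem,
`(∂ₜ⁻¹ w)(t) = ∫₀ᵗ w(s) ds` for `w ∈ L²(0,T)`. -/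
def dtInv (T : ℝ) (w : StrongDual ℝ (HHalf T)) : L2 T :=
  (InnerProductSpace.toDual ℝ (L2 T)).symm (-(w ∘L dtBarInv T))

/-! ### The boundary `Σ = {0, L} × (0,T)` and the single layer operator -/

/-- `H^{1/2}_{,0}(Σ) = H^{1/2}_{,0}(0,T) × H^{1/2}_{,0}(0,T)` with the norm
`(‖z₀‖² + ‖z_L‖²)^{1/2}`. -/
abbrev HHalfSigma (T : ℝ) : Type := WithLp 2 (HHalf T × HHalf T)

/-- The component `w₀` of `w = (w₀, w_L) ∈ [H^{1/2}_{,0}(Σ)]'`. -/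
def dualFst {T : ℝ} (w : StrongDual ℝ (HHalfSigma T)) : StrongDual ℝ (HHalf T) :=
  w ∘L ((WithLp.prodContinuousLinearEquiv 2 ℝ (HHalf T) (HHalf T)).symm :
    HHalf T × HHalf T →L[ℝ] HHalfSigma T) ∘L ContinuousLinearMap.inl ℝ (HHalf T) (HHalf T)

/-- The component `w_L` of `w = (w₀, w_L) ∈ [H^{1/2}_{,0}(Σ)]'`. -/
def dualSnd {T : ℝ} (w : StrongDual ℝ (HHalfSigma T)) : StrongDual ℝ (HHalf T) :=
  w ∘L ((WithLp.prodContinuousLinearEquiv 2 ℝ (HHalf T) (HHalf T)).symm :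
    HHalf T × HHalf T →L[ℝ] HHalfSigma T) ∘L ContinuousLinearMap.inr ℝ (HHalf T) (HHalf T)

/-- The delay `z ↦ z(· - L)`, where `z` is extended by zero outside of `(0,T)`. -/
def shiftFun (T L : ℝ) (z : L2 T) (t : ℝ) : ℝ := (Ioo 0 T).indicator z (t - L)

theorem shiftFun_memLp (T L : ℝ) (z : L2 T) :
    MemLp (shiftFun T L z) 2 (volume.restrict (Ioo 0 T)) := by
  have h : MemLp ((Ioo 0 T).indicator z) 2 volume :=
    (memLp_indicator_iff_restrict measurableSet_Ioo).2 (Lp.memLp z)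
  exact (h.comp_measurePreserving (measurePreserving_sub_right volume L)).restrict _

/-- The delay `z ↦ z(· - L)` on `L²(0,T)`. -/
def shift (T L : ℝ) (z : L2 T) : L2 T := (shiftFun_memLp T L z).toLp

/-- The first component
`V₀ w = (1/2) ∫₀ᵗ w₀(s) ds + (1/2) ∫₀^{t-L} w_L(s) ds` of the single layer operator, extended to
densities `w ∈ [H^{1/2}_{,0}(Σ)]'`. -/
def singleLayerZero (T L : ℝ) (w : StrongDual ℝ (HHalfSigma T)) : L2 T :=
  (1 / 2 : ℝ) • (dtInv T (dualFst w) + shift T L (dtInv T (dualSnd w)))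

/-- The second component
`V_L w = (1/2) ∫₀^{t-L} w₀(s) ds + (1/2) ∫₀ᵗ w_L(s) ds` of the single layer operator, extended to
densities `w ∈ [H^{1/2}_{,0}(Σ)]'`. -/
def singleLayerEnd (T L : ℝ) (w : StrongDual ℝ (HHalfSigma T)) : L2 T :=
  (1 / 2 : ℝ) • (shift T L (dtInv T (dualFst w)) + dtInv T (dualSnd w))

/-! ### The modified Hilbert transformation -/

/-- The Fourier coefficient `u_k = (2/T) ∫₀ᵀ u(t) sin((π/2 + kπ) t/T) dt`. -/
def sinCoeff (T : ℝ) (k : ℕ) (u : L2 T) : ℝ :=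
  2 / T * ∫ t in (0 : ℝ)..T, u t * Real.sin ((Real.pi / 2 + k * Real.pi) * (t / T))

theorem cos_memLp (T : ℝ) (k : ℕ) :
    MemLp (fun t : ℝ => Real.cos ((Real.pi / 2 + k * Real.pi) * (t / T))) 2
      (volume.restrict (Ioo 0 T)) :=
  MemLp.of_bound (by fun_prop) 1 (Filter.Eventually.of_forall fun t => Real.abs_cos_le_one _)

/-- The function `t ↦ cos((π/2 + kπ) t/T)` in `L²(0,T)`. -/
def cosL2 (T : ℝ) (k : ℕ) : L2 T := (cos_memLp T k).toLp

/-- The modified Hilbert transformation `H_T u = ∑ₖ u_k cos((π/2 + kπ) t/T)`, where the series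
(orthogonal, with square summable coefficients) converges in `L²(0,T)`. -/
def hilbertT (T : ℝ) (u : L2 T) : L2 T := ∑' k : ℕ, sinCoeff T k u • cosL2 T k

/-! ### The matrices `C_m` -/

/-- The coefficients `b_{kℓ}`. -/
def bCoeff (T L : ℝ) (k l : ℕ) : ℝ :=
  if k = l then
    2 * (1 - L / T) * Real.cos ((Real.pi / 2 + k * Real.pi) * (L / T))
  else if (2 : ℤ) ∣ (k : ℤ) - l then
    4 / Real.pi * (√(2 * k + 1) * √(2 * l + 1) / (((k : ℝ) + l + 1) * ((k : ℝ) - l))) *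
      Real.cos (((k : ℝ) + l + 1) * (Real.pi / 2) * (L / T)) *
      Real.sin (((l : ℝ) - k) * (Real.pi / 2) * (L / T))
  else 0

/-- The matrix `C_m ∈ ℝ^{(m+1)×(m+1)}`: zero if `T ≤ L`, and with the entries
`c_{ℓi} = ∑ₖ b_{kℓ} b_{ki}` if `T > L`. -/
def cMatrix (T L : ℝ) (m : ℕ) : Matrix (Fin (m + 1)) (Fin (m + 1)) ℝ :=
  if T ≤ L then 0 else Matrix.of fun l i => ∑' k : ℕ, bCoeff T L k l * bCoeff T L k i

theorem cMatrix_isHermitian (T L : ℝ) (m : ℕ) : (cMatrix T L m).IsHermitian := by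
  unfold cMatrix
  split_ifs
  · exact Matrix.isHermitian_zero
  · ext l i
    simp [Matrix.conjTranspose_apply, mul_comm]

/-- The maximal eigenvalue of `C_m`. -/
def lambdaMax (T L : ℝ) (m : ℕ) : ℝ := ⨆ i, (cMatrix_isHermitian T L m).eigenvalues i

end WaveBIE

end

/-!
Let `ω_k = (π/2 + kπ)/T`. The functions `(2/T)^{1/2} cos(ω_k t)` form an orthonormal basis of
`L²(0,T)` (`cosBasis`); completeness follows from the Weierstrass approximation theorem, since their
span is `cos(πt/2T)` times the polynomials in `cos(πt/T)`. The primitive vanishing at `T` maps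
`sin(ω_k t)` to `-cos(ω_k t)/ω_k` (`inner_cosL2_prim`, `prim_sinL2`), so the infimum in the
`K`-functional splits into one scalar quadratic problem per frequency (`kFun_sq`). Integration over
`τ` identifies `H^{1/2}_{,0}(0,T)` isometrically with `ℓ²` by `f ↦ (ω_k^{1/2} f_k)_k`, where `f_k`
are the coefficients in the cosine basis (`HHalf.coeff`). In these coordinates `H_T ∂ₜ⁻¹` is the
Riesz isomorphism of `[H^{1/2}_{,0}(0,T)]'` with `H^{1/2}_{,0}(0,T)` (`hilbertT_dtInv`).

The delay by `L` is the `L²`-adjoint of the advance `f ↦ f(· + L)`. The advance commutes with the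
primitive vanishing at `T` and contracts both norms in the `K`-functional. It is therefore a
contraction `N` of `H^{1/2}_{,0}(0,T)`, and the delay of `∂ₜ⁻¹ φ` is `∂ₜ⁻¹ (φ ∘ N)`
(`shift_dtInv`). Hence, if `x` and `y` are the Riesz representatives of the components of `w`,
then `⟨H_T V w, w⟩ = (‖x‖² + ‖y‖² + ⟨x, B y⟩)/2` with the self-adjoint operator `B = N + N*` on `ℓ²`,
whose norm is at most `2` (`apply_hilbertT_singleLayer`).

If `L < T`, the matrix of `B` is `(b_{kℓ})` by an explicit integration (`inner_unitSeq_coupling`),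
and `B = 0` if `T ≤ L`. In both cases `C_m` is the Gram matrix of the first `m + 1` columns of `B`,
so `√λ_max(C_m)` is the norm of `B` on sequences supported in `{0, …, m}`. These norms are bounded by
`2`, and their supremum bounds `B` by density (`norm_coupling_apply_le`). The estimate then follows
from `‖x‖ ‖y‖ ≤ (‖x‖² + ‖y‖²)/2`.
-/

noncomputable section

namespace WaveBIE

open scoped InnerProductSpace

/-! ### Trigonometric integrals -/

theorem integral_cos_add_mul_cos {a b : ℝ} (hab : a ^ 2 ≠ b ^ 2) (L S : ℝ) :
    ∫ t in (0 : ℝ)..S, Real.cos (a * (t + L)) * Real.cos (b * t) =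
      (a * Real.sin (a * (S + L)) * Real.cos (b * S) -
        b * Real.cos (a * (S + L)) * Real.sin (b * S) - a * Real.sin (a * L)) /
        (a ^ 2 - b ^ 2) := by
  have hab' : a ^ 2 - b ^ 2 ≠ 0 := sub_ne_zero.2 hab
  have h (t : ℝ) : HasDerivAt (fun t => (a * Real.sin (a * (t + L)) * Real.cos (b * t) -
      b * Real.cos (a * (t + L)) * Real.sin (b * t)) / (a ^ 2 - b ^ 2))
      (Real.cos (a * (t + L)) * Real.cos (b * t)) t := by
    have h1 : HasDerivAt (fun t => a * (t + L)) a t := by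
      simpa using ((hasDerivAt_id t).add_const L).const_mul a
    have h2 : HasDerivAt (fun t => b * t) b t := by simpa using (hasDerivAt_id t).const_mul b
    refine (((((h1.sin).const_mul a).mul h2.cos).sub
      (((h1.cos).const_mul b).mul h2.sin)).div_const (a ^ 2 - b ^ 2)).congr_deriv ?_
    field_simp
    ring
  rw [intervalIntegral.integral_eq_sub_of_hasDerivAt (fun t _ => h t)
    (Continuous.intervalIntegrable (by fun_prop) _ _)]
  simp
  ring

theorem integral_cos_add_mul_cos_self {a : ℝ} (ha : a ≠ 0) (L S : ℝ) :
    ∫ t in (0 : ℝ)..S, Real.cos (a * (t + L)) * Real.cos (a * t) =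
      S / 2 * Real.cos (a * L) + (Real.sin (a * (2 * S + L)) - Real.sin (a * L)) / (4 * a) := by
  have h (t : ℝ) : HasDerivAt (fun t => t / 2 * Real.cos (a * L) +
      Real.sin (a * (2 * t + L)) / (4 * a)) (Real.cos (a * (t + L)) * Real.cos (a * t)) t := by
    have h1 : HasDerivAt (fun t => a * (2 * t + L)) (a * 2) t := by
      simpa using (((hasDerivAt_id t).const_mul 2).add_const L).const_mul a
    refine ((((hasDerivAt_id t).div_const 2).mul_const (Real.cos (a * L))).add
      (h1.sin.div_const (4 * a))).congr_deriv ?_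
    have e1 : a * L = a * (t + L) - a * t := by ring
    have e2 : a * (2 * t + L) = a * (t + L) + a * t := by ring
    rw [e1, e2, Real.cos_sub, Real.cos_add]
    field_simp
    ring
  rw [intervalIntegral.integral_eq_sub_of_hasDerivAt (fun t _ => h t)
    (Continuous.intervalIntegrable (by fun_prop) _ _)]
  simp
  ring

theorem integral_sin_mul_sin {a b : ℝ} (hab : a ^ 2 ≠ b ^ 2) (S : ℝ) :
    ∫ t in (0 : ℝ)..S, Real.sin (a * t) * Real.sin (b * t) =
      (b * Real.sin (a * S) * Real.cos (b * S) - a * Real.cos (a * S) * Real.sin (b * S)) /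
        (a ^ 2 - b ^ 2) := by
  have hab' : a ^ 2 - b ^ 2 ≠ 0 := sub_ne_zero.2 hab
  have h (t : ℝ) : HasDerivAt (fun t => (b * Real.sin (a * t) * Real.cos (b * t) -
      a * Real.cos (a * t) * Real.sin (b * t)) / (a ^ 2 - b ^ 2))
      (Real.sin (a * t) * Real.sin (b * t)) t := by
    have h1 : HasDerivAt (fun t => a * t) a t := by simpa using (hasDerivAt_id t).const_mul a
    have h2 : HasDerivAt (fun t => b * t) b t := by simpa using (hasDerivAt_id t).const_mul b
    refine (((((h1.sin).const_mul b).mul h2.cos).sub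
      (((h1.cos).const_mul a).mul h2.sin)).div_const (a ^ 2 - b ^ 2)).congr_deriv ?_
    field_simp
    ring
  rw [intervalIntegral.integral_eq_sub_of_hasDerivAt (fun t _ => h t)
    (Continuous.intervalIntegrable (by fun_prop) _ _)]
  simp

/-! ### The sine and cosine systems -/

/-- The frequency `ω_k = (π/2 + kπ)/T`. -/
def freq (T : ℝ) (k : ℕ) : ℝ := (Real.pi / 2 + k * Real.pi) / T

theorem freq_pos {T : ℝ} (hT : 0 < T) (k : ℕ) : 0 < freq T k := by
  have := Real.pi_pos
  unfold freq
  positivity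

theorem freq_mul (T : ℝ) (k : ℕ) (t : ℝ) :
    freq T k * t = (Real.pi / 2 + k * Real.pi) * (t / T) := by
  unfold freq; ring

theorem freq_mul_end {T : ℝ} (hT : 0 < T) (k : ℕ) : freq T k * T = k * Real.pi + Real.pi / 2 := by
  unfold freq; field_simp; ring

theorem cos_freq_end {T : ℝ} (hT : 0 < T) (k : ℕ) : Real.cos (freq T k * T) = 0 := by
  rw [freq_mul_end hT, Real.cos_add_pi_div_two, Real.sin_nat_mul_pi, neg_zero]

theorem sin_freq_end {T : ℝ} (hT : 0 < T) (k : ℕ) : Real.sin (freq T k * T) = (-1) ^ k := by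
  rw [freq_mul_end hT, Real.sin_add_pi_div_two, Real.cos_nat_mul_pi]

theorem freq_injective {T : ℝ} (hT : 0 < T) : Function.Injective (freq T) := by
  intro j k h
  unfold freq at h
  have := (div_left_inj' hT.ne').1 h
  have h2 : (j : ℝ) * Real.pi = k * Real.pi := by linarith
  exact_mod_cast mul_right_cancel₀ Real.pi_ne_zero h2

theorem freq_sq_ne {T : ℝ} (hT : 0 < T) {j k : ℕ} (h : j ≠ k) : freq T j ^ 2 ≠ freq T k ^ 2 := by
  intro h2
  exact h (freq_injective hT
    ((sq_eq_sq₀ (freq_pos hT j).le (freq_pos hT k).le).1 h2))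

theorem sin_memLp (T : ℝ) (k : ℕ) :
    MemLp (fun t : ℝ => Real.sin ((Real.pi / 2 + k * Real.pi) * (t / T))) 2
      (volume.restrict (Ioo 0 T)) :=
  MemLp.of_bound (by fun_prop) 1 (Filter.Eventually.of_forall fun t => Real.abs_sin_le_one _)

/-- The function `t ↦ sin((π/2 + kπ) t/T)` in `L²(0,T)`. -/
def sinL2 (T : ℝ) (k : ℕ) : L2 T := (sin_memLp T k).toLp

theorem coeFn_cosL2 (T : ℝ) (k : ℕ) :
    cosL2 T k =ᵐ[volume.restrict (Ioo 0 T)] fun t => Real.cos (freq T k * t) := by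
  simp only [freq_mul]
  exact (cos_memLp T k).coeFn_toLp

theorem coeFn_sinL2 (T : ℝ) (k : ℕ) :
    sinL2 T k =ᵐ[volume.restrict (Ioo 0 T)] fun t => Real.sin (freq T k * t) := by
  simp only [freq_mul]
  exact (sin_memLp T k).coeFn_toLp

theorem inner_eq_integral {T : ℝ} (hT : 0 < T) {f g : L2 T} {F G : ℝ → ℝ}
    (hf : f =ᵐ[volume.restrict (Ioo 0 T)] F) (hg : g =ᵐ[volume.restrict (Ioo 0 T)] G) :
    ⟪f, g⟫_ℝ = ∫ t in (0 : ℝ)..T, F t * G t := by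
  rw [L2.inner_def, intervalIntegral.integral_of_le hT.le, ← restrict_Ioo_eq_restrict_Ioc]
  refine integral_congr_ae ?_
  filter_upwards [hf, hg] with t h1 h2
  rw [h1, h2]
  simp [mul_comm]

theorem inner_cosL2 {T : ℝ} (hT : 0 < T) (j k : ℕ) :
    ⟪cosL2 T j, cosL2 T k⟫_ℝ = if j = k then T / 2 else 0 := by
  rw [inner_eq_integral hT (coeFn_cosL2 T j) (coeFn_cosL2 T k)]
  split_ifs with h
  · subst h
    have := integral_cos_add_mul_cos_self (freq_pos hT j).ne' 0 T
    have e : freq T j * (2 * T) = 2 * (freq T j * T) := by ring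
    simp only [add_zero] at this
    rw [this, e, Real.sin_two_mul, cos_freq_end hT]
    simp
  · have := integral_cos_add_mul_cos (freq_sq_ne hT h) 0 T
    simp only [add_zero] at this
    rw [this, cos_freq_end hT, cos_freq_end hT]
    simp

theorem inner_sinL2 {T : ℝ} (hT : 0 < T) (j k : ℕ) :
    ⟪sinL2 T j, sinL2 T k⟫_ℝ = if j = k then T / 2 else 0 := by
  rw [inner_eq_integral hT (coeFn_sinL2 T j) (coeFn_sinL2 T k)]
  split_ifs with h
  · subst h
    have h1 := integral_cos_add_mul_cos_self (freq_pos hT j).ne' 0 T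
    have e : freq T j * (2 * T) = 2 * (freq T j * T) := by ring
    simp only [add_zero] at h1
    rw [e, Real.sin_two_mul, cos_freq_end hT] at h1
    have h2 (t : ℝ) : Real.sin (freq T j * t) * Real.sin (freq T j * t) =
        1 - Real.cos (freq T j * t) * Real.cos (freq T j * t) := by
      nlinarith [Real.sin_sq_add_cos_sq (freq T j * t)]
    simp only [h2]
    rw [intervalIntegral.integral_sub (by simp) (Continuous.intervalIntegrable (by fun_prop) _ _),
      h1]
    simp
    ring
  · rw [integral_sin_mul_sin (freq_sq_ne hT h), cos_freq_end hT, cos_freq_end hT]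
    simp

/-- A function orthogonal to all polynomials in `cos(πt/T)` vanishes, by the Weierstrass
approximation theorem in the variable `cos(πt/T) ∈ [-1,1]`. -/
theorem ae_eq_zero_of_integral_mul_polynomial_cos {T : ℝ} (hT : 0 < T) {h : ℝ → ℝ}
    (hh : IntegrableOn h (Ioo 0 T))
    (h0 : ∀ p : Polynomial ℝ, ∫ t in Ioo 0 T, h t * p.eval (Real.cos (Real.pi * t / T)) = 0) :
    h =ᵐ[volume.restrict (Ioo 0 T)] 0 := by
  have hcont (g : ℝ → ℝ) (hg : Continuous g) : ∫ t in Ioo 0 T, h t * g t = 0 := by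
    have hint (q : ℝ → ℝ) (hq : Continuous q) : IntegrableOn (fun t => h t * q t) (Ioo 0 T) := by
      obtain ⟨C, hC⟩ := isCompact_Icc.exists_bound_of_continuousOn (s := Icc 0 T) hq.continuousOn
      refine Integrable.mul_bdd (c := C) hh hq.aestronglyMeasurable ?_
      filter_upwards [ae_restrict_mem measurableSet_Ioo] with t ht
      exact hC t (Ioo_subset_Icc_self ht)
    set I := ∫ t in Ioo 0 T, ‖h t‖ with hI
    have hI0 : 0 ≤ I := integral_nonneg fun _ => norm_nonneg _
    rw [← norm_le_zero_iff]
    refine le_of_forall_pos_le_add fun ε hε => ?_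
    obtain ⟨p, hp⟩ := exists_polynomial_near_of_continuousOn (-1) 1
      (fun y => g (T / Real.pi * Real.arccos y))
      (hg.comp (continuous_const.mul Real.continuous_arccos)).continuousOn (ε / (I + 1))
      (by positivity)
    have hp' : ∀ t ∈ Ioo 0 T, ‖g t - p.eval (Real.cos (Real.pi * t / T))‖ ≤ ε / (I + 1) := by
      intro t ht
      have h1 := hp (Real.cos (Real.pi * t / T)) ⟨Real.neg_one_le_cos _, Real.cos_le_one _⟩
      have h2 : 0 ≤ Real.pi * t / T := by have := ht.1; have := Real.pi_pos; positivity
      have h3 : Real.pi * t / T ≤ Real.pi := by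
        rw [div_le_iff₀ hT]; exact mul_le_mul_of_nonneg_left ht.2.le Real.pi_pos.le
      rw [Real.arccos_cos h2 h3] at h1
      have h4 : T / Real.pi * (Real.pi * t / T) = t := by field_simp
      rw [h4, abs_sub_comm] at h1
      exact h1.le
    have hpc : Continuous fun t => p.eval (Real.cos (Real.pi * t / T)) :=
      p.continuous.comp (by fun_prop)
    have e : ∫ t in Ioo 0 T, h t * g t =
        ∫ t in Ioo 0 T, h t * (g t - p.eval (Real.cos (Real.pi * t / T))) := by
      simp only [mul_sub]
      rw [integral_sub (hint g hg) (hint _ hpc), h0, sub_zero]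
    rw [e, zero_add]
    calc _ ≤ ∫ t in Ioo 0 T, ‖h t‖ * (ε / (I + 1)) := by
          refine norm_integral_le_of_norm_le (hh.norm.mul_const _) ?_
          filter_upwards [ae_restrict_mem measurableSet_Ioo] with t ht
          rw [norm_mul]
          exact mul_le_mul_of_nonneg_left (hp' t ht) (norm_nonneg _)
      _ = I / (I + 1) * ε := by rw [integral_mul_const]; ring
      _ ≤ 1 * ε := by
          gcongr
          rw [div_le_one (by positivity)]
          linarith
      _ = ε := one_mul ε
  have h1 := isOpen_Ioo.ae_eq_zero_of_integral_contDiff_smul_eq_zero (μ := volume)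
    hh.locallyIntegrableOn (fun g hg _ hs => by
      rw [← hcont g hg.continuous, ← setIntegral_eq_integral_of_forall_compl_eq_zero (s := Ioo 0 T)]
      · simp [mul_comm]
      · intro t ht
        rw [image_eq_zero_of_notMem_tsupport fun h' => ht (hs h'), zero_smul])
  exact (ae_restrict_iff' measurableSet_Ioo).2 h1

/-- `cos(ω_k t) p(cos(πt/T))` is a linear combination of the `cos(ω_j t)`, by the addition theorem
`2 cos(ω_j t) cos(πt/T) = cos(ω_{j+1} t) + cos(ω_{j-1} t)` with `ω_{-1} = -ω₀`. -/
theorem cos_mul_polynomial_mem_span (T : ℝ) (p : Polynomial ℝ) (k : ℕ) :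
    (fun t => Real.cos (freq T k * t) * p.eval (Real.cos (Real.pi * t / T))) ∈
      Submodule.span ℝ (range fun k t => Real.cos (freq T k * t)) := by
  induction p using Polynomial.induction_on' generalizing k with
  | add p q hp hq =>
    convert Submodule.add_mem _ (hp k) (hq k) using 1
    ext t
    simp [mul_add]
  | monomial n a =>
    suffices H : ∀ k, (fun t => Real.cos (freq T k * t) * Real.cos (Real.pi * t / T) ^ n) ∈
        Submodule.span ℝ (range fun k t => Real.cos (freq T k * t)) by
      convert Submodule.smul_mem _ a (H k) using 1
      ext t
      simp
      ring
    induction n with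
    | zero => exact fun k => Submodule.subset_span ⟨k, by simp⟩
    | succ n ih =>
      intro k
      have e1 (t : ℝ) : freq T (k + 1) * t = freq T k * t + Real.pi * t / T := by
        unfold freq; push_cast; ring
      rcases k with _ | k
      · have e2 (t : ℝ) : freq T 0 * t - Real.pi * t / T = -(freq T 0 * t) := by
          unfold freq; push_cast; ring
        convert Submodule.smul_mem _ (1 / 2 : ℝ) (Submodule.add_mem _ (ih 1) (ih 0)) using 1
        ext t
        have h1 := Real.cos_add (freq T 0 * t) (Real.pi * t / T)
        have h2 := Real.cos_sub (freq T 0 * t) (Real.pi * t / T)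
        rw [e2, Real.cos_neg] at h2
        simp only [zero_add] at e1
        simp only [Pi.smul_apply, Pi.add_apply, smul_eq_mul, e1, pow_succ]
        linear_combination (-1 / 2 * Real.cos (Real.pi * t / T) ^ n) * (h1 + h2)
      · have e2 (t : ℝ) : freq T k * t = freq T (k + 1) * t - Real.pi * t / T := by
          unfold freq; push_cast; ring
        convert Submodule.smul_mem _ (1 / 2 : ℝ) (Submodule.add_mem _ (ih (k + 2)) (ih k)) using 1
        ext t
        have h1 := Real.cos_add (freq T (k + 1) * t) (Real.pi * t / T)
        have h2 := Real.cos_sub (freq T (k + 1) * t) (Real.pi * t / T)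
        simp only [Pi.smul_apply, Pi.add_apply, smul_eq_mul]
        rw [e2, e1, pow_succ]
        linear_combination (-1 / 2 * Real.cos (Real.pi * t / T) ^ n) * (h1 + h2)

/-- Completeness of the cosine system. -/
theorem eq_zero_of_inner_cosL2 {T : ℝ} (hT : 0 < T) {f : L2 T}
    (hf : ∀ k, ⟪cosL2 T k, f⟫_ℝ = 0) : f = 0 := by
  have hint (q : ℝ → ℝ) (hq : Continuous q) : IntegrableOn (fun t => f t * q t) (Ioo 0 T) := by
    obtain ⟨C, hC⟩ := isCompact_Icc.exists_bound_of_continuousOn (s := Icc 0 T) hq.continuousOn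
    refine Integrable.mul_bdd (c := C) (integrableOn T f) hq.aestronglyMeasurable ?_
    filter_upwards [ae_restrict_mem measurableSet_Ioo] with t ht
    exact hC t (Ioo_subset_Icc_self ht)
  have hspan : ∀ m ∈ Submodule.span ℝ (range fun k t => Real.cos (freq T k * t)),
      Continuous m ∧ ∫ t in Ioo 0 T, f t * m t = 0 := by
    intro m hm
    induction hm using Submodule.span_induction with
    | mem m hm =>
      obtain ⟨k, rfl⟩ := hm
      refine ⟨by fun_prop, ?_⟩
      refine Eq.trans ?_ (hf k)
      rw [inner_eq_integral hT (coeFn_cosL2 T k) Filter.EventuallyEq.rfl,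
        intervalIntegral.integral_of_le hT.le, ← restrict_Ioo_eq_restrict_Ioc]
      simp [mul_comm]
    | zero => exact ⟨continuous_const, by simp⟩
    | add m m' _ _ h h' =>
      refine ⟨h.1.add h'.1, ?_⟩
      simp only [Pi.add_apply, mul_add]
      rw [integral_add (hint m h.1) (hint m' h'.1), h.2, h'.2, add_zero]
    | smul c m _ h =>
      refine ⟨h.1.const_smul c, ?_⟩
      simp only [Pi.smul_apply, smul_eq_mul, mul_left_comm _ c]
      rw [integral_const_mul, h.2, mul_zero]
  have h1 := ae_eq_zero_of_integral_mul_polynomial_cos hT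
    (h := fun t => f t * Real.cos (freq T 0 * t)) (hint _ (by fun_prop)) (fun p => by
      simp only [mul_assoc]
      exact (hspan _ (cos_mul_polynomial_mem_span T p 0)).2)
  refine Lp.ext ?_
  filter_upwards [h1, ae_restrict_mem measurableSet_Ioo, Lp.coeFn_zero ℝ 2
    (volume.restrict (Ioo 0 T))] with t ht h2 h3
  rw [h3]
  -- `cos(ω₀t)` has no zero in `(0,T)`, where `0 < ω₀t < π/2`
  refine (mul_eq_zero.1 ht).resolve_right (Real.cos_pos_of_mem_Ioo ⟨?_, ?_⟩).ne'
  · have := mul_pos (freq_pos hT 0) h2.1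
    linarith [Real.pi_pos]
  · have := mul_lt_mul_of_pos_left h2.2 (freq_pos hT 0)
    rw [freq_mul_end hT] at this
    simpa using this

theorem orthonormal_cos {T : ℝ} (hT : 0 < T) : Orthonormal ℝ fun k => √(2 / T) • cosL2 T k := by
  rw [orthonormal_iff_ite]
  intro j k
  rw [real_inner_smul_left, real_inner_smul_right, inner_cosL2 hT, ← mul_assoc,
    Real.mul_self_sqrt (by positivity)]
  split_ifs
  · field_simp
  · simp

theorem orthonormal_sin {T : ℝ} (hT : 0 < T) : Orthonormal ℝ fun k => √(2 / T) • sinL2 T k := by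
  rw [orthonormal_iff_ite]
  intro j k
  rw [real_inner_smul_left, real_inner_smul_right, inner_sinL2 hT, ← mul_assoc,
    Real.mul_self_sqrt (by positivity)]
  split_ifs
  · field_simp
  · simp

/-- The orthonormal basis `(2/T)^{1/2} cos(ω_k t)` of `L²(0,T)`. -/
def cosBasis {T : ℝ} (hT : 0 < T) : HilbertBasis ℕ ℝ (L2 T) :=
  HilbertBasis.mkOfOrthogonalEqBot (orthonormal_cos hT) (by
    rw [Submodule.eq_bot_iff]
    intro f hf
    refine eq_zero_of_inner_cosL2 hT fun k => ?_
    have h := hf _ (Submodule.subset_span ⟨k, rfl⟩)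
    rw [real_inner_smul_left] at h
    exact (mul_eq_zero.1 h).resolve_left (by positivity))

theorem cosBasis_apply {T : ℝ} (hT : 0 < T) (k : ℕ) : cosBasis hT k = √(2 / T) • cosL2 T k := by
  unfold cosBasis
  rw [HilbertBasis.coe_mkOfOrthogonalEqBot]

/-! ### The primitive in the trigonometric systems -/

theorem primFun_eq_integral_indicator {T : ℝ} (g : L2 T) {t : ℝ} (ht : t ∈ Ioo 0 T) :
    primFun T g t = -∫ s in Ioo 0 T, {p : ℝ × ℝ | p.1 < p.2}.indicator (fun p => g p.2) (t, s) := by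
  unfold primFun
  rw [intervalIntegral.integral_of_le ht.2.le, ← restrict_Ioo_eq_restrict_Ioc]
  congr 1
  have : (fun s => {p : ℝ × ℝ | p.1 < p.2}.indicator (fun p => g p.2) (t, s)) =
      (Ioi t).indicator g := by
    ext s; simp [indicator_apply]
  rw [this, setIntegral_indicator measurableSet_Ioi, Ioo_inter_Ioi, max_eq_right ht.1.le]

/-- Integration by parts against `cos(ωt)` for a primitive vanishing at `T`; the boundary term at
`0` vanishes because `sin(ωt)` does. -/
theorem integral_cos_mul_primFun {T ω : ℝ} (hω : ω ≠ 0) (g : L2 T) :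
    ∫ t in Ioo 0 T, Real.cos (ω * t) * primFun T g t =
      -(ω⁻¹ * ∫ s in Ioo 0 T, Real.sin (ω * s) * g s) := by
  set F : ℝ × ℝ → ℝ := {p : ℝ × ℝ | p.1 < p.2}.indicator fun p => Real.cos (ω * p.1) * g p.2
    with hF
  have hcos : Integrable (fun t => Real.cos (ω * t)) (volume.restrict (Ioo 0 T)) :=
    Integrable.of_bound (by fun_prop) 1 (Filter.Eventually.of_forall fun t => Real.abs_cos_le_one _)
  have hFi : Integrable F ((volume.restrict (Ioo 0 T)).prod (volume.restrict (Ioo 0 T))) :=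
    (hcos.mul_prod (integrableOn T g)).indicator (measurableSet_lt measurable_fst measurable_snd)
  have h1 : ∫ t in Ioo 0 T, Real.cos (ω * t) * primFun T g t =
      -∫ t in Ioo 0 T, ∫ s in Ioo 0 T, F (t, s) := by
    rw [← integral_neg]
    refine setIntegral_congr_fun measurableSet_Ioo fun t ht => ?_
    simp only [primFun_eq_integral_indicator g ht, mul_neg, neg_inj]
    rw [← integral_const_mul]
    congr 1
    ext s
    simp only [hF, indicator_apply]
    split_ifs <;> simp
  rw [h1, integral_integral_swap (f := fun t s => F (t, s)) hFi, ← integral_const_mul]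
  congr 1
  refine setIntegral_congr_fun measurableSet_Ioo fun s hs => ?_
  have e : (fun t => F (t, s)) = (Iio s).indicator fun t => Real.cos (ω * t) * g s := by
    ext t; simp [hF, indicator_apply]
  simp only [e]
  rw [setIntegral_indicator measurableSet_Iio, Ioo_inter_Iio, min_eq_right hs.2.le,
    integral_mul_const, restrict_Ioo_eq_restrict_Ioc, ← intervalIntegral.integral_of_le hs.1.le,
    intervalIntegral.integral_comp_mul_left (fun t => Real.cos t) hω, integral_cos]
  simp [mul_assoc]

theorem inner_cosL2_prim {T : ℝ} (hT : 0 < T) (k : ℕ) (g : L2 T) :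
    ⟪cosL2 T k, prim T g⟫_ℝ = -((freq T k)⁻¹ * ⟪sinL2 T k, g⟫_ℝ) := by
  rw [prim, inner_eq_integral hT (coeFn_cosL2 T k) (primFun_memLp T g).coeFn_toLp,
    inner_eq_integral hT (coeFn_sinL2 T k) Filter.EventuallyEq.rfl,
    intervalIntegral.integral_of_le hT.le, intervalIntegral.integral_of_le hT.le,
    ← restrict_Ioo_eq_restrict_Ioc]
  exact integral_cos_mul_primFun (freq_pos hT k).ne' g

theorem cosBasis_repr_prim {T : ℝ} (hT : 0 < T) (k : ℕ) (g : L2 T) :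
    (cosBasis hT).repr (prim T g) k = -((freq T k)⁻¹ * ⟪√(2 / T) • sinL2 T k, g⟫_ℝ) := by
  rw [HilbertBasis.repr_apply_apply, cosBasis_apply, real_inner_smul_left, inner_cosL2_prim hT,
    real_inner_smul_left]
  ring

theorem prim_sinL2 {T : ℝ} (hT : 0 < T) (k : ℕ) :
    prim T (sinL2 T k) = -((freq T k)⁻¹ • cosL2 T k) := by
  rw [← sub_eq_zero]
  refine eq_zero_of_inner_cosL2 hT fun j => ?_
  rw [inner_sub_right, inner_cosL2_prim hT, inner_neg_right, real_inner_smul_right, inner_cosL2 hT,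
    inner_sinL2 hT]
  split_ifs with h
  · rw [h]; ring
  · simp

/-! ### The interpolation norm in terms of cosine coefficients -/

theorem hasSum_sq_cosBasis_repr {T : ℝ} (hT : 0 < T) (f : L2 T) :
    HasSum (fun k => (cosBasis hT).repr f k ^ 2) (‖f‖ ^ 2) := by
  have h := lp.hasSum_inner (𝕜 := ℝ) ((cosBasis hT).repr f) ((cosBasis hT).repr f)
  rw [real_inner_self_eq_norm_sq, LinearIsometryEquiv.norm_map] at h
  simpa [sq] using h

theorem sq_mul_le_add_sq (a y τ ω : ℝ) :
    τ ^ 2 * ω ^ 2 / (1 + τ ^ 2 * ω ^ 2) * a ^ 2 ≤ (a - y) ^ 2 + τ ^ 2 * (ω * y) ^ 2 := by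
  rw [div_mul_eq_mul_div, div_le_iff₀ (by positivity)]
  nlinarith [sq_nonneg (y * (1 + τ ^ 2 * ω ^ 2) - a)]

/-- The weights `τ²ω²/(1 + τ²ω²)` by which the squared `K`-functional acts on coefficients. -/
def kWeight (T τ : ℝ) (k : ℕ) : ℝ := τ ^ 2 * freq T k ^ 2 / (1 + τ ^ 2 * freq T k ^ 2)

theorem kWeight_nonneg (T τ : ℝ) (k : ℕ) : 0 ≤ kWeight T τ k := by unfold kWeight; positivity

theorem kWeight_le_one (T τ : ℝ) (k : ℕ) : kWeight T τ k ≤ 1 := by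
  unfold kWeight
  rw [div_le_one (by positivity)]
  linarith

theorem summable_kWeight {T : ℝ} (hT : 0 < T) (τ : ℝ) (f : L2 T) :
    Summable fun k => kWeight T τ k * (cosBasis hT).repr f k ^ 2 :=
  (hasSum_sq_cosBasis_repr hT f).summable.of_nonneg_of_le
    (fun k => mul_nonneg (kWeight_nonneg T τ k) (sq_nonneg _))
    (fun k => mul_le_of_le_one_left (sq_nonneg _) (kWeight_le_one T τ k))

/-- The scalar bounds are summed by Parseval's identity for the cosines and Bessel's inequality for
the sines; completeness of the sines is not needed. -/
theorem tsum_kWeight_le {T : ℝ} (hT : 0 < T) (τ : ℝ) (f g : L2 T) :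
    ∑' k, kWeight T τ k * (cosBasis hT).repr f k ^ 2 ≤
      ‖f - prim T g‖ ^ 2 + τ ^ 2 * ‖g‖ ^ 2 := by
  have hs := hasSum_sq_cosBasis_repr hT (f - prim T g)
  have hb := (orthonormal_sin hT).inner_products_summable (x := g)
  have hb' := (orthonormal_sin hT).tsum_inner_products_le (x := g)
  simp only [Real.norm_eq_abs, sq_abs] at hb hb'
  calc _ ≤ ∑' k, ((cosBasis hT).repr (f - prim T g) k ^ 2 +
        τ ^ 2 * ⟪√(2 / T) • sinL2 T k, g⟫_ℝ ^ 2) := by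
        refine (summable_kWeight hT τ f).tsum_le_tsum (fun k => ?_)
          (hs.summable.add (hb.mul_left _))
        have h := sq_mul_le_add_sq ((cosBasis hT).repr f k) ((cosBasis hT).repr (prim T g) k) τ
          (freq T k)
        refine h.trans (le_of_eq ?_)
        rw [map_sub, lp.coeFn_sub, Pi.sub_apply, cosBasis_repr_prim hT]
        have := (freq_pos hT k).ne'
        field_simp
    _ = ‖f - prim T g‖ ^ 2 + τ ^ 2 * ∑' k, ⟪√(2 / T) • sinL2 T k, g⟫_ℝ ^ 2 := by
        rw [hs.summable.tsum_add (hb.mul_left _), hs.tsum_eq, tsum_mul_left]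
    _ ≤ _ := by gcongr

/-- The minimizer of the `K`-functional solves one scalar quadratic problem per frequency. -/
theorem exists_tsum_kWeight_eq {T τ : ℝ} (hT : 0 < T) (hτ : 0 < τ) (f : L2 T) :
    ∃ g : L2 T, ∑' k, kWeight T τ k * (cosBasis hT).repr f k ^ 2 =
      ‖f - prim T g‖ ^ 2 + τ ^ 2 * ‖g‖ ^ 2 := by
  set a := fun k => (cosBasis hT).repr f k with ha
  -- the sine coefficients of the derivative of the minimizer `∑ₖ (1 + τ²ω_k²)⁻¹ a_k cos(ω_k t)`
  set y : ℕ → ℝ := fun k => -(freq T k / (1 + τ ^ 2 * freq T k ^ 2)) * a k with hy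
  have hmem : Memℓp y 2 := by
    rw [memℓp_gen_iff (by norm_num)]
    refine Summable.of_nonneg_of_le (fun k => by positivity) (fun k => ?_)
      ((hasSum_sq_cosBasis_repr hT f).summable.mul_left (τ⁻¹ ^ 2))
    simp only [ENNReal.toReal_ofNat, Real.rpow_ofNat, Real.norm_eq_abs, sq_abs, hy, neg_mul,
      neg_sq]
    rw [mul_pow]
    refine mul_le_mul_of_nonneg_right ?_ (sq_nonneg _)
    have := freq_pos hT k
    refine pow_le_pow_left₀ (by positivity) ?_ 2
    rw [div_le_iff₀ (by positivity), inv_mul_eq_div, le_div_iff₀ hτ]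
    nlinarith [sq_nonneg (τ * freq T k - 1)]
  set Y : lp (fun _ : ℕ => ℝ) 2 := ⟨y, hmem⟩ with hY
  have hO := (orthonormal_sin hT).orthogonalFamily
  set g : L2 T := hO.linearIsometry Y with hg
  have hgY : ‖g‖ ^ 2 = ∑' k, y k ^ 2 := by
    rw [hg, LinearIsometry.norm_map, ← real_inner_self_eq_norm_sq, lp.inner_eq_tsum]
    simp [hY, sq]
  have hys : Summable fun k => y k ^ 2 := by
    have := lp.summable_inner (𝕜 := ℝ) Y Y
    simpa [hY, sq] using this
  have hgi (k : ℕ) : ⟪√(2 / T) • sinL2 T k, g⟫_ℝ = y k := by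
    have h1 : √(2 / T) • sinL2 T k = hO.linearIsometry (lp.single 2 k (1 : ℝ)) := by
      rw [hO.linearIsometry_apply_single]
      simp
    rw [h1, hg, LinearIsometry.inner_map_map, lp.inner_single_left]
    simp [hY]
  refine ⟨g, ?_⟩
  have hs := hasSum_sq_cosBasis_repr hT (f - prim T g)
  rw [hgY, ← hs.tsum_eq, ← tsum_mul_left, ← hs.summable.tsum_add (hys.mul_left _)]
  refine tsum_congr fun k => ?_
  rw [map_sub, lp.coeFn_sub, Pi.sub_apply, cosBasis_repr_prim hT, hgi]
  have := freq_pos hT k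
  have h1 : (0 : ℝ) < 1 + τ ^ 2 * freq T k ^ 2 := by positivity
  simp only [hy, kWeight, ← ha]
  change _ * a k ^ 2 = (a k - _) ^ 2 + _
  field_simp
  ring

theorem kFun_sq {T τ : ℝ} (hT : 0 < T) (hτ : 0 < τ) (f : L2 T) :
    kFun T τ f ^ 2 = ∑' k, kWeight T τ k * (cosBasis hT).repr f k ^ 2 := by
  refine le_antisymm ?_ ?_
  · obtain ⟨g, hg⟩ := exists_tsum_kWeight_eq hT hτ f
    rw [hg, ← Real.sq_sqrt (by positivity : 0 ≤ ‖f - prim T g‖ ^ 2 + τ ^ 2 * ‖g‖ ^ 2)]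
    exact pow_le_pow_left₀ (kFun_nonneg _ _ _) (kFun_le T τ f ⟨(prim T g, g), prim_isH1Final T g⟩) 2
  · rw [← Real.sqrt_le_left (kFun_nonneg _ _ _)]
    refine le_ciInf fun p => Real.sqrt_le_sqrt ?_
    rw [IsH1Final.eq_prim p.2]
    exact tsum_kWeight_le hT τ f p.1.2

/-- The substitution `x = ωτ` in `∫₀^∞ dx/(1 + x²) = π/2`; this is where the factor `2/π` in the norm
comes from. -/
theorem lintegral_kWeight {T : ℝ} (hT : 0 < T) (k : ℕ) {a : ℝ} :
    ∫⁻ τ in Ioi (0 : ℝ), ENNReal.ofReal (kWeight T τ k * a ^ 2 / τ ^ 2) =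
      ENNReal.ofReal (Real.pi / 2 * (freq T k * a ^ 2)) := by
  have hω := freq_pos hT k
  have e : ∀ τ ∈ Ioi (0 : ℝ), kWeight T τ k * a ^ 2 / τ ^ 2 =
      freq T k ^ 2 * a ^ 2 * (1 + (freq T k * τ) ^ 2)⁻¹ := by
    intro τ hτ
    have hτ' : (0 : ℝ) < τ := hτ
    unfold kWeight
    have h1 : (0 : ℝ) < 1 + τ ^ 2 * freq T k ^ 2 := by positivity
    have h2 : (0 : ℝ) < 1 + (freq T k * τ) ^ 2 := by positivity
    field_simp
  rw [setLIntegral_congr_fun measurableSet_Ioi fun τ hτ => by rw [e τ hτ],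
    ← ofReal_integral_eq_lintegral_ofReal]
  · rw [integral_const_mul, integral_comp_mul_left_Ioi (fun x => (1 + x ^ 2)⁻¹) 0 hω, mul_zero,
      integral_Ioi_inv_one_add_sq, Real.arctan_zero]
    congr 1
    simp only [smul_eq_mul]
    field_simp
    ring
  · exact ((integrable_inv_one_add_sq.comp_mul_left' hω.ne').integrableOn).const_mul _
  · exact Filter.Eventually.of_forall fun τ => by positivity

theorem eLpNorm_kFun_sq {T : ℝ} (hT : 0 < T) (f : L2 T) :
    eLpNorm (fun τ => kFun T τ f / τ) 2 (volume.restrict (Ioi 0)) ^ 2 =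
      ∑' k, ENNReal.ofReal (Real.pi / 2 * (freq T k * (cosBasis hT).repr f k ^ 2)) := by
  have h := eLpNorm_nnreal_pow_eq_lintegral (p := 2) (f := fun τ => kFun T τ f / τ)
    (μ := volume.restrict (Ioi 0)) (by norm_num)
  simp only [ENNReal.coe_ofNat, NNReal.coe_ofNat, ENNReal.rpow_ofNat] at h
  rw [h]
  have h1 : ∀ τ ∈ Ioi (0 : ℝ), ‖kFun T τ f / τ‖ₑ ^ 2 =
      ∑' k, ENNReal.ofReal (kWeight T τ k * (cosBasis hT).repr f k ^ 2 / τ ^ 2) := by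
    intro τ hτ
    rw [← ENNReal.ofReal_tsum_of_nonneg, tsum_div_const, ← kFun_sq hT hτ, ← div_pow,
      Real.enorm_eq_ofReal (div_nonneg (kFun_nonneg _ _ _) (le_of_lt hτ)), ENNReal.ofReal_pow
      (div_nonneg (kFun_nonneg _ _ _) (le_of_lt hτ))]
    · exact fun k => div_nonneg (mul_nonneg (kWeight_nonneg T τ k) (sq_nonneg _)) (sq_nonneg _)
    · exact (summable_kWeight hT τ f).div_const _
  rw [setLIntegral_congr_fun measurableSet_Ioi h1, lintegral_tsum]
  · exact tsum_congr fun k => lintegral_kWeight hT k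
  · intro k
    unfold kWeight
    exact Measurable.aemeasurable (by fun_prop)

theorem mem_hHalfSubmodule_iff {T : ℝ} (hT : 0 < T) (f : L2 T) :
    f ∈ hHalfSubmodule T ↔ Summable fun k => freq T k * (cosBasis hT).repr f k ^ 2 := by
  have hpi : Real.pi / 2 ≠ 0 := by positivity
  have h0 (k : ℕ) : 0 ≤ Real.pi / 2 * (freq T k * (cosBasis hT).repr f k ^ 2) := by
    have := freq_pos hT k
    positivity
  have h1 : f ∈ hHalfSubmodule T ↔
      eLpNorm (fun τ => kFun T τ f / τ) 2 (volume.restrict (Ioi 0)) ^ 2 ≠ ⊤ := by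
    rw [Ne, ENNReal.pow_eq_top_iff]
    have hm : AEStronglyMeasurable (fun τ => kFun T τ f / τ) (volume.restrict (Ioi 0)) :=
      ((kFun_measurable T f).div measurable_id).aestronglyMeasurable
    change MemLp _ _ _ ↔ _
    simp [MemLp, hm, lt_top_iff_ne_top]
  rw [h1, eLpNorm_kFun_sq hT, ← summable_mul_left_iff hpi]
  constructor
  · intro h
    have := ENNReal.summable_toReal h
    simpa only [ENNReal.toReal_ofReal (h0 _)] using this
  · intro h
    rw [← ENNReal.ofReal_tsum_of_nonneg h0 h]
    exact ENNReal.ofReal_ne_top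

theorem HHalf.norm_sq {T : ℝ} (hT : 0 < T) (f : HHalf T) :
    ‖f‖ ^ 2 = ∑' k, freq T k * (cosBasis hT).repr f.val k ^ 2 := by
  have hs : Summable fun k => freq T k * (cosBasis hT).repr f.val k ^ 2 :=
    (mem_hHalfSubmodule_iff hT f.val).1 f.memLp
  have h0 (k : ℕ) : 0 ≤ Real.pi / 2 * (freq T k * (cosBasis hT).repr f.val k ^ 2) := by
    have := freq_pos hT k
    positivity
  rw [HHalf.norm_def, mul_pow, Real.sq_sqrt (by positivity), ← ENNReal.toReal_pow,
    eLpNorm_kFun_sq hT, ← ENNReal.ofReal_tsum_of_nonneg h0 (hs.mul_left _),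
    ENNReal.toReal_ofReal (tsum_nonneg h0), tsum_mul_left, ← mul_assoc]
  field_simp

/-! ### The isometry of `H^{1/2}_{,0}(0,T)` with `ℓ²` -/

/-- The real sequence space `ℓ²`. -/
abbrev SeqL2 : Type := lp (fun _ : ℕ => ℝ) 2

theorem memlp_two_iff_summable_sq {x : ℕ → ℝ} : Memℓp x 2 ↔ Summable fun k => x k ^ 2 := by
  rw [memℓp_gen_iff (by norm_num)]
  simp

theorem SeqL2.norm_sq (x : SeqL2) : ‖x‖ ^ 2 = ∑' k, x k ^ 2 := by
  rw [← real_inner_self_eq_norm_sq, lp.inner_eq_tsum]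
  simp [sq]

theorem sq_sqrt_freq_mul {T : ℝ} (hT : 0 < T) (k : ℕ) (a : ℝ) :
    (√(freq T k) * a) ^ 2 = freq T k * a ^ 2 := by
  rw [mul_pow, Real.sq_sqrt (freq_pos hT k).le]

/-- The isometry `f ↦ (ω_k^{1/2} f_k)_k` of `H^{1/2}_{,0}(0,T)` into `ℓ²`, where `f_k` are the
coefficients of `f` in the orthonormal cosine basis. -/
def HHalf.coeffIsometry {T : ℝ} (hT : 0 < T) : HHalf T →ₗᵢ[ℝ] SeqL2 where
  toFun f := ⟨fun k => √(freq T k) * (cosBasis hT).repr f.val k, by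
    have h := (mem_hHalfSubmodule_iff hT f.val).1 f.memLp
    refine memlp_two_iff_summable_sq.2 ?_
    simpa only [sq_sqrt_freq_mul hT] using h⟩
  map_add' f g := by
    ext k
    simp [HHalf.val_add, mul_add]
    rfl
  map_smul' c f := by
    ext k
    simp [HHalf.val_smul]
    ring
  norm_map' f := by
    rw [← sq_eq_sq₀ (norm_nonneg _) (norm_nonneg _), HHalf.norm_sq hT, SeqL2.norm_sq]
    exact tsum_congr fun k => sq_sqrt_freq_mul hT k _

theorem freq_zero_le {T : ℝ} (hT : 0 < T) (k : ℕ) : freq T 0 ≤ freq T k := by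
  have := Real.pi_pos
  unfold freq
  gcongr
  simp

theorem HHalf.coeffIsometry_surjective {T : ℝ} (hT : 0 < T) :
    Function.Surjective (HHalf.coeffIsometry hT) := by
  intro x
  have hx : Summable fun k => x k ^ 2 := memlp_two_iff_summable_sq.1 x.2
  have hsq (k : ℕ) : √(freq T k) ≠ 0 := (Real.sqrt_pos.2 (freq_pos hT k)).ne'
  have ha : Memℓp (fun k => (√(freq T k))⁻¹ * x k) 2 := by
    refine memlp_two_iff_summable_sq.2 (Summable.of_nonneg_of_le (fun k => sq_nonneg _)
      (fun k => ?_) (hx.mul_left (freq T 0)⁻¹))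
    rw [mul_pow, inv_pow, Real.sq_sqrt (freq_pos hT k).le]
    have := freq_pos hT 0
    have := freq_zero_le hT k
    gcongr
  set f : L2 T := (cosBasis hT).repr.symm ⟨_, ha⟩ with hf
  have hfk (k : ℕ) : (cosBasis hT).repr f k = (√(freq T k))⁻¹ * x k := by
    rw [hf, LinearIsometryEquiv.apply_symm_apply]
  have hmem : f ∈ hHalfSubmodule T := by
    rw [mem_hHalfSubmodule_iff hT]
    refine hx.congr fun k => ?_
    rw [hfk, mul_pow, inv_pow, Real.sq_sqrt (freq_pos hT k).le,
      mul_inv_cancel_left₀ (freq_pos hT k).ne']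
  refine ⟨HHalf.mk f hmem, ?_⟩
  ext k
  change √(freq T k) * (cosBasis hT).repr f k = x k
  rw [hfk, mul_inv_cancel_left₀ (hsq k)]

/-- The isometric isomorphism `f ↦ (ω_k^{1/2} f_k)_k` of `H^{1/2}_{,0}(0,T)` with `ℓ²`. -/
def HHalf.coeff {T : ℝ} (hT : 0 < T) : HHalf T ≃ₗᵢ[ℝ] SeqL2 :=
  LinearIsometryEquiv.ofSurjective (HHalf.coeffIsometry hT) (HHalf.coeffIsometry_surjective hT)

theorem HHalf.coeff_apply {T : ℝ} (hT : 0 < T) (f : HHalf T) (k : ℕ) :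
    HHalf.coeff hT f k = √(freq T k) * (cosBasis hT).repr f.val k := rfl

/-- The `ℓ²` sequence that represents a functional on `H^{1/2}_{,0}(0,T)`. -/
def riesz {T : ℝ} (hT : 0 < T) (φ : StrongDual ℝ (HHalf T)) : SeqL2 :=
  (InnerProductSpace.toDual ℝ SeqL2).symm
    (φ ∘L ((HHalf.coeff hT).symm.toContinuousLinearEquiv : SeqL2 →L[ℝ] HHalf T))

theorem inner_riesz {T : ℝ} (hT : 0 < T) (φ : StrongDual ℝ (HHalf T)) (x : SeqL2) :
    ⟪riesz hT φ, x⟫_ℝ = φ ((HHalf.coeff hT).symm x) := by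
  unfold riesz
  rw [InnerProductSpace.toDual_symm_apply]
  rfl

theorem apply_eq_inner_riesz {T : ℝ} (hT : 0 < T) (φ : StrongDual ℝ (HHalf T)) (f : HHalf T) :
    φ f = ⟪riesz hT φ, HHalf.coeff hT f⟫_ℝ := by
  rw [inner_riesz, LinearIsometryEquiv.symm_apply_apply]

theorem riesz_add {T : ℝ} (hT : 0 < T) (φ ψ : StrongDual ℝ (HHalf T)) :
    riesz hT (φ + ψ) = riesz hT φ + riesz hT ψ :=
  ext_inner_right ℝ fun x => by simp [inner_riesz, inner_add_left]

theorem riesz_smul {T : ℝ} (hT : 0 < T) (c : ℝ) (φ : StrongDual ℝ (HHalf T)) :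
    riesz hT (c • φ) = c • riesz hT φ :=
  ext_inner_right ℝ fun x => by simp [inner_riesz, real_inner_smul_left]

/-! ### The modified Hilbert transformation of `∂ₜ⁻¹` is the Riesz map -/

theorem inner_dtInv (T : ℝ) (φ : StrongDual ℝ (HHalf T)) (v : L2 T) :
    ⟪dtInv T φ, v⟫_ℝ = -φ (dtBarInv T v) := by
  unfold dtInv
  rw [InnerProductSpace.toDual_symm_apply]
  rfl

theorem dtInv_add (T : ℝ) (φ ψ : StrongDual ℝ (HHalf T)) :
    dtInv T (φ + ψ) = dtInv T φ + dtInv T ψ :=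
  ext_inner_right ℝ fun v => by simp [inner_dtInv, inner_add_left, add_comm]

theorem dtInv_smul (T : ℝ) (c : ℝ) (φ : StrongDual ℝ (HHalf T)) :
    dtInv T (c • φ) = c • dtInv T φ :=
  ext_inner_right ℝ fun v => by simp [inner_dtInv, real_inner_smul_left]

/-- The sequence unit vector `δ_k`. -/
abbrev unitSeq (k : ℕ) : SeqL2 := lp.single 2 k (1 : ℝ)

theorem inner_unitSeq (k : ℕ) (x : SeqL2) : ⟪unitSeq k, x⟫_ℝ = x k := by
  rw [lp.inner_single_left]
  simp

theorem coeff_symm_unitSeq_val {T : ℝ} (hT : 0 < T) (k : ℕ) :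
    ((HHalf.coeff hT).symm (unitSeq k)).val = (√(freq T k))⁻¹ • cosBasis hT k := by
  apply (cosBasis hT).repr.injective
  ext j
  have h := HHalf.coeff_apply hT ((HHalf.coeff hT).symm (unitSeq k)) j
  rw [LinearIsometryEquiv.apply_symm_apply] at h
  have hsq (k : ℕ) : √(freq T k) ≠ 0 := (Real.sqrt_pos.2 (freq_pos hT k)).ne'
  rw [map_smul, lp.coeFn_smul, Pi.smul_apply, HilbertBasis.repr_self]
  rcases eq_or_ne j k with rfl | hjk
  · rw [lp.single_apply_self] at h ⊢
    have := hsq j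
    simp only [smul_eq_mul]
    field_simp
    linarith
  · rw [lp.single_apply_ne _ _ _ hjk] at h ⊢
    simpa [hsq j] using h.symm

theorem sinCoeff_eq_inner {T : ℝ} (hT : 0 < T) (k : ℕ) (u : L2 T) :
    sinCoeff T k u = 2 / T * ⟪u, sinL2 T k⟫_ℝ := by
  rw [inner_eq_integral hT Filter.EventuallyEq.rfl (coeFn_sinL2 T k)]
  simp only [sinCoeff, freq_mul]

theorem dtBarInv_sinL2 {T : ℝ} (hT : 0 < T) (k : ℕ) :
    dtBarInv T (sinL2 T k) = -((√(2 / T) * √(freq T k))⁻¹ •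
      (HHalf.coeff hT).symm (unitSeq k)) := by
  refine Subtype.ext ?_
  change prim T (sinL2 T k) = -((√(2 / T) * √(freq T k))⁻¹ •
      ((HHalf.coeff hT).symm (unitSeq k)).val)
  rw [coeff_symm_unitSeq_val, prim_sinL2 hT, cosBasis_apply, smul_smul, smul_smul]
  congr 2
  have h1 : √(2 / T) ≠ 0 := by positivity
  rw [mul_inv, mul_assoc, mul_right_comm, ← mul_assoc, mul_comm _ (√(2 / T)), ← mul_assoc,
    mul_inv_cancel₀ h1, one_mul, ← mul_inv, Real.mul_self_sqrt (freq_pos hT k).le]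

theorem sinCoeff_dtInv {T : ℝ} (hT : 0 < T) (k : ℕ) (φ : StrongDual ℝ (HHalf T)) :
    sinCoeff T k (dtInv T φ) = √(2 / T) * (√(freq T k))⁻¹ * riesz hT φ k := by
  rw [sinCoeff_eq_inner hT, inner_dtInv, dtBarInv_sinL2 hT, map_neg, map_smul, neg_neg,
    ← inner_riesz, real_inner_comm, inner_unitSeq]
  have h : 2 / T = √(2 / T) * √(2 / T) := (Real.mul_self_sqrt (by positivity)).symm
  have h1 : √(2 / T) ≠ 0 := by positivity
  generalize √(2 / T) = r at h h1 ⊢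
  rw [h, mul_inv, smul_eq_mul]
  field_simp

/-- The composition of `H_T` with `∂ₜ⁻¹` is the Riesz isomorphism of the dual space of
`H^{1/2}_{,0}(0,T)` with `H^{1/2}_{,0}(0,T)`. -/
theorem hilbertT_dtInv {T : ℝ} (hT : 0 < T) (φ : StrongDual ℝ (HHalf T)) :
    hilbertT T (dtInv T φ) = ((HHalf.coeff hT).symm (riesz hT φ)).val := by
  set f := (HHalf.coeff hT).symm (riesz hT φ) with hf
  have h := (cosBasis hT).hasSum_repr f.val
  unfold hilbertT
  rw [← h.tsum_eq]
  refine tsum_congr fun k => ?_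
  have h2 := HHalf.coeff_apply hT f k
  rw [hf, LinearIsometryEquiv.apply_symm_apply, ← hf] at h2
  have hsq : √(freq T k) ≠ 0 := (Real.sqrt_pos.2 (freq_pos hT k)).ne'
  rw [sinCoeff_dtInv hT, h2, cosBasis_apply, smul_smul]
  congr 1
  field_simp

/-! ### Delay and advance -/

theorem coeFn_shift_of_ae_eq {T : ℝ} (L : ℝ) {z : L2 T} {Z : ℝ → ℝ}
    (h : z =ᵐ[volume.restrict (Ioo 0 T)] Z) :
    shift T L z =ᵐ[volume.restrict (Ioo 0 T)] fun t => (Ioo 0 T).indicator Z (t - L) := by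
  have h1 : (Ioo 0 T).indicator z =ᵐ[volume] (Ioo 0 T).indicator Z := by
    filter_upwards [(ae_restrict_iff' measurableSet_Ioo).1 h] with t ht
    by_cases hm : t ∈ Ioo 0 T
    · rw [indicator_of_mem hm, indicator_of_mem hm, ht hm]
    · rw [indicator_of_notMem hm, indicator_of_notMem hm]
  refine (shiftFun_memLp T L z).coeFn_toLp.trans (ae_restrict_of_ae ?_)
  exact (measurePreserving_sub_right volume L).quasiMeasurePreserving.ae_eq_comp h1

theorem inner_eq_integral_indicator {T : ℝ} (u v : L2 T) {U : ℝ → ℝ}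
    (hu : u =ᵐ[volume.restrict (Ioo 0 T)] U) :
    ⟪u, v⟫_ℝ = ∫ t, U t * (Ioo 0 T).indicator v t := by
  have e : (fun t => U t * (Ioo 0 T).indicator v t) = (Ioo 0 T).indicator fun t => U t * v t := by
    ext t
    simp only [indicator_apply]
    split_ifs <;> simp
  rw [e, integral_indicator measurableSet_Ioo, L2.inner_def]
  refine integral_congr_ae ?_
  filter_upwards [hu] with t ht
  simp [ht, mul_comm]

/-- The adjoint of the delay by `L` is the advance by `L`. -/
theorem inner_shift {T : ℝ} (L : ℝ) (z v : L2 T) :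
    ⟪shift T L z, v⟫_ℝ = ⟪z, shift T (-L) v⟫_ℝ := by
  rw [shift, shift, inner_eq_integral_indicator _ _ (shiftFun_memLp T L z).coeFn_toLp, real_inner_comm,
    inner_eq_integral_indicator _ _ (shiftFun_memLp T (-L) v).coeFn_toLp,
    ← integral_add_right_eq_self _ L]
  simp [shiftFun, mul_comm]

theorem shift_add (T L : ℝ) (z z' : L2 T) : shift T L (z + z') = shift T L z + shift T L z' :=
  ext_inner_right ℝ fun v => by simp [inner_shift, inner_add_left]

theorem shift_smul (T L c : ℝ) (z : L2 T) : shift T L (c • z) = c • shift T L z :=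
  ext_inner_right ℝ fun v => by simp [inner_shift, real_inner_smul_left]

theorem norm_shift_le (T L : ℝ) (z : L2 T) : ‖shift T L z‖ ≤ ‖z‖ := by
  rw [shift, Lp.norm_toLp, Lp.norm_def]
  refine ENNReal.toReal_mono (Lp.eLpNorm_ne_top z) ?_
  refine (eLpNorm_mono_measure _ Measure.restrict_le_self).trans ?_
  have h : AEStronglyMeasurable ((Ioo 0 T).indicator z) volume :=
    ((memLp_indicator_iff_restrict measurableSet_Ioo).2 (Lp.memLp z)).1
  exact ((eLpNorm_comp_measurePreserving h (measurePreserving_sub_right volume L)).trans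
    (eLpNorm_indicator_eq_eLpNorm_restrict measurableSet_Ioo)).le

/-- The advance commutes with the primitive vanishing at `T`. -/
theorem shift_prim {T L : ℝ} (hL : 0 ≤ L) (g : L2 T) :
    shift T (-L) (prim T g) = prim T (shift T (-L) g) := by
  refine Lp.ext ?_
  filter_upwards [coeFn_shift_of_ae_eq (-L) (primFun_memLp T g).coeFn_toLp,
    (primFun_memLp T (shift T (-L) g)).coeFn_toLp, ae_restrict_mem measurableSet_Ioo]
    with t h1 h2 ht
  rw [prim, h1, prim, h2]
  have e : primFun T (shift T (-L) g) t = -∫ s in t..T, (Ioo 0 T).indicator g (s + L) := by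
    unfold primFun
    rw [intervalIntegral.integral_of_le ht.2.le, intervalIntegral.integral_of_le ht.2.le,
      ← restrict_Ioo_eq_restrict_Ioc]
    congr 1
    refine integral_congr_ae (ae_restrict_of_ae_restrict_of_subset
      (Ioo_subset_Ioo_left ht.1.le) ?_)
    have h3 := coeFn_shift_of_ae_eq (-L) (Filter.EventuallyEq.refl _ (g : ℝ → ℝ))
    simp only [sub_neg_eq_add] at h3
    exact h3
  rw [e, intervalIntegral.integral_comp_add_right (fun s => (Ioo 0 T).indicator g s), sub_neg_eq_add,
    intervalIntegral.integral_of_le (by linarith [ht.2]), setIntegral_indicator measurableSet_Ioo]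
  by_cases hs : t + L < T
  · have h0 : t + L ∈ Ioo 0 T := ⟨by linarith [ht.1], hs⟩
    have e2 : Ioc (t + L) (T + L) ∩ Ioo 0 T = Ioo (t + L) T := by
      ext s
      simp only [mem_inter_iff, mem_Ioc, mem_Ioo]
      constructor
      · rintro ⟨⟨a, b⟩, c, d⟩; exact ⟨a, d⟩
      · rintro ⟨a, b⟩; exact ⟨⟨a, by linarith⟩, by linarith [h0.1], b⟩
    rw [indicator_of_mem h0, e2, primFun, intervalIntegral.integral_of_le hs.le,
      integral_Ioc_eq_integral_Ioo]
  · have e2 : Ioc (t + L) (T + L) ∩ Ioo 0 T = ∅ := by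
      ext s
      simp only [mem_inter_iff, mem_Ioc, mem_Ioo, mem_empty_iff_false, iff_false]
      rintro ⟨⟨a, b⟩, c, d⟩
      exact hs (by linarith)
    rw [indicator_of_notMem (fun h => hs h.2), e2]
    simp

/-- The advance contracts both norms in the `K`-functional. -/
theorem kFun_shift_le (T τ : ℝ) {L : ℝ} (hL : 0 ≤ L) (f : L2 T) :
    kFun T τ (shift T (-L) f) ≤ kFun T τ f := by
  refine le_ciInf fun p => ?_
  have hp : prim T (shift T (-L) p.1.2) = shift T (-L) p.1.1 := by
    rw [← shift_prim hL, ← IsH1Final.eq_prim p.2]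
  refine (kFun_le T τ _ ⟨(prim T (shift T (-L) p.1.2), shift T (-L) p.1.2),
    prim_isH1Final T _⟩).trans (Real.sqrt_le_sqrt ?_)
  have e : shift T (-L) f - shift T (-L) p.1.1 = shift T (-L) (f - p.1.1) := by
    rw [sub_eq_add_neg, sub_eq_add_neg, shift_add, ← neg_one_smul ℝ p.1.1, shift_smul, neg_one_smul]
  simp only [hp, e]
  gcongr <;> exact norm_shift_le T _ _

theorem norm_kFun_shift_le (T : ℝ) {L : ℝ} (hL : 0 ≤ L) (f : L2 T) (τ : ℝ) :
    ‖kFun T τ (shift T (-L) f) / τ‖ ≤ ‖kFun T τ f / τ‖ := by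
  rw [norm_div, norm_div, Real.norm_of_nonneg (kFun_nonneg _ _ _),
    Real.norm_of_nonneg (kFun_nonneg _ _ _)]
  gcongr
  exact kFun_shift_le T τ hL f

theorem shift_mem {T L : ℝ} (hL : 0 ≤ L) (f : HHalf T) :
    shift T (-L) f.val ∈ hHalfSubmodule T :=
  f.memLp.mono ((kFun_measurable T _).div measurable_id).aestronglyMeasurable
    (Filter.Eventually.of_forall (norm_kFun_shift_le T hL f.val))

theorem norm_mk_shift_le {T L : ℝ} (hL : 0 ≤ L) (f : HHalf T) :
    ‖HHalf.mk (shift T (-L) f.val) (shift_mem hL f)‖ ≤ ‖f‖ := by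
  rw [HHalf.norm_def, HHalf.norm_def]
  exact mul_le_mul_of_nonneg_left (ENNReal.toReal_mono f.memLp.eLpNorm_ne_top
    (eLpNorm_mono (norm_kFun_shift_le T hL f.val))) (Real.sqrt_nonneg _)

/-- The advance `f ↦ f(· + L)`, where `f` is extended by zero, as a contraction of
`H^{1/2}_{,0}(0,T)`. -/
def advance (T : ℝ) {L : ℝ} (hL : 0 ≤ L) : HHalf T →L[ℝ] HHalf T :=
  LinearMap.mkContinuous
    { toFun := fun f => HHalf.mk (shift T (-L) f.val) (shift_mem hL f)
      map_add' := fun f g => Subtype.ext (shift_add T (-L) f.val g.val)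
      map_smul' := fun c f => Subtype.ext (shift_smul T (-L) c f.val) }
    1 (fun f => (norm_mk_shift_le hL f).trans (one_mul ‖f‖).ge)

theorem advance_val {T L : ℝ} (hL : 0 ≤ L) (f : HHalf T) :
    (advance T hL f).val = shift T (-L) f.val := rfl

theorem norm_advance_le {T L : ℝ} (hL : 0 ≤ L) (f : HHalf T) : ‖advance T hL f‖ ≤ ‖f‖ :=
  norm_mk_shift_le hL f

/-- The delay of `∂ₜ⁻¹ φ` is `∂ₜ⁻¹` of the functional `f ↦ φ(f(· + L))`. -/
theorem shift_dtInv {T L : ℝ} (hL : 0 ≤ L) (φ : StrongDual ℝ (HHalf T)) :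
    shift T L (dtInv T φ) = dtInv T (φ ∘L advance T hL) := by
  refine ext_inner_right ℝ fun v => ?_
  rw [inner_shift, inner_dtInv, inner_dtInv, ContinuousLinearMap.comp_apply]
  congr 2
  exact Subtype.ext (shift_prim hL v).symm

/-! ### The coupling operator and its matrix -/

/-- The advance by `L`, acting on the sequence space `ℓ²`. -/
def advanceSeq {T L : ℝ} (hT : 0 < T) (hL : 0 ≤ L) : SeqL2 →L[ℝ] SeqL2 :=
  ((HHalf.coeff hT).toContinuousLinearEquiv : HHalf T →L[ℝ] SeqL2) ∘L advance T hL ∘L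
    ((HHalf.coeff hT).symm.toContinuousLinearEquiv : SeqL2 →L[ℝ] HHalf T)

theorem advanceSeq_apply {T L : ℝ} (hT : 0 < T) (hL : 0 ≤ L) (x : SeqL2) :
    advanceSeq hT hL x = HHalf.coeff hT (advance T hL ((HHalf.coeff hT).symm x)) := rfl

theorem norm_advanceSeq_le {T L : ℝ} (hT : 0 < T) (hL : 0 ≤ L) : ‖advanceSeq hT hL‖ ≤ 1 :=
  ContinuousLinearMap.opNorm_le_bound _ zero_le_one fun x => by
    rw [advanceSeq_apply, LinearIsometryEquiv.norm_map, one_mul]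
    exact (norm_advance_le hL _).trans (LinearIsometryEquiv.norm_map _ _).le

/-- The symmetrized advance, whose matrix has the entries `b_{kℓ}` if `L < T`. -/
def coupling {T L : ℝ} (hT : 0 < T) (hL : 0 ≤ L) : SeqL2 →L[ℝ] SeqL2 :=
  advanceSeq hT hL + ContinuousLinearMap.adjoint (advanceSeq hT hL)

theorem norm_coupling_le {T L : ℝ} (hT : 0 < T) (hL : 0 ≤ L) : ‖coupling hT hL‖ ≤ 2 := by
  refine (norm_add_le _ _).trans ?_
  rw [LinearIsometryEquiv.norm_map]
  linarith [norm_advanceSeq_le hT hL]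

theorem inner_cosL2_shift {T L : ℝ} (hT : 0 < T) (hL : 0 ≤ L) (hLT : L ≤ T) (k l : ℕ) :
    ⟪cosL2 T k, shift T (-L) (cosL2 T l)⟫_ℝ =
      ∫ t in (0 : ℝ)..(T - L), Real.cos (freq T l * (t + L)) * Real.cos (freq T k * t) := by
  rw [inner_eq_integral hT (coeFn_cosL2 T k) (coeFn_shift_of_ae_eq (-L) (coeFn_cosL2 T l)),
    intervalIntegral.integral_of_le hT.le, ← restrict_Ioo_eq_restrict_Ioc,
    intervalIntegral.integral_of_le (by linarith), ← restrict_Ioo_eq_restrict_Ioc]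
  have e : Ioo 0 (T - L) = Ioo 0 T ∩ Iio (T - L) := by
    rw [Ioo_inter_Iio, min_eq_right (by linarith)]
  rw [e, ← setIntegral_indicator measurableSet_Iio]
  refine setIntegral_congr_fun measurableSet_Ioo fun t ht => ?_
  have h1 : t - -L ∈ Ioo 0 T ↔ t ∈ Iio (T - L) := by
    simp only [mem_Ioo, mem_Iio]
    constructor
    · rintro ⟨_, h⟩; linarith
    · intro h; constructor <;> linarith [ht.1]
  by_cases h : t ∈ Iio (T - L)
  · rw [indicator_of_mem h, indicator_of_mem (h1.2 h), sub_neg_eq_add, mul_comm]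
  · rw [indicator_of_notMem h, indicator_of_notMem fun h' => h (h1.1 h'), mul_zero]

theorem inner_unitSeq_advanceSeq {T L : ℝ} (hT : 0 < T) (hL : 0 ≤ L) (hLT : L ≤ T) (k l : ℕ) :
    ⟪unitSeq k, advanceSeq hT hL (unitSeq l)⟫_ℝ = √(freq T k) * (√(freq T l))⁻¹ * (2 / T) *
      ∫ t in (0 : ℝ)..(T - L), Real.cos (freq T l * (t + L)) * Real.cos (freq T k * t) := by
  rw [inner_unitSeq, advanceSeq_apply, HHalf.coeff_apply, advance_val, coeff_symm_unitSeq_val,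
    HilbertBasis.repr_apply_apply, cosBasis_apply, cosBasis_apply, shift_smul, shift_smul,
    real_inner_smul_left, real_inner_smul_right, real_inner_smul_right,
    inner_cosL2_shift hT hL hLT]
  have h : 2 / T = √(2 / T) * √(2 / T) := (Real.mul_self_sqrt (by positivity)).symm
  generalize √(2 / T) = r at h ⊢
  rw [h]
  ring

theorem inner_unitSeq_coupling_eq_add {T L : ℝ} (hT : 0 < T) (hL : 0 ≤ L) (k l : ℕ) :
    ⟪unitSeq k, coupling hT hL (unitSeq l)⟫_ℝ =
      ⟪unitSeq k, advanceSeq hT hL (unitSeq l)⟫_ℝ +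
      ⟪unitSeq l, advanceSeq hT hL (unitSeq k)⟫_ℝ := by
  rw [coupling, add_apply, inner_add_right,
    ContinuousLinearMap.adjoint_inner_right, real_inner_comm (unitSeq l)]

theorem cos_freq_mul_sub {T : ℝ} (hT : 0 < T) (L : ℝ) (k : ℕ) :
    Real.cos (freq T k * (T - L)) = (-1) ^ k * Real.sin (freq T k * L) := by
  rw [mul_sub, Real.cos_sub, cos_freq_end hT, sin_freq_end hT]
  ring

theorem sqrt_freq {T : ℝ} (hT : 0 < T) (k : ℕ) :
    √(freq T k) = √(Real.pi / (2 * T)) * √(2 * k + 1) := by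
  have := Real.pi_pos
  rw [← Real.sqrt_mul (by positivity)]
  congr 1
  unfold freq
  field_simp
  ring

theorem inner_unitSeq_coupling_self {T L : ℝ} (hT : 0 < T) (hL : 0 ≤ L) (hLT : L ≤ T) (k : ℕ) :
    ⟪unitSeq k, coupling hT hL (unitSeq k)⟫_ℝ = 2 * (1 - L / T) * Real.cos (freq T k * L) := by
  rw [inner_unitSeq_coupling_eq_add, inner_unitSeq_advanceSeq hT hL hLT]
  have hω := freq_pos hT k
  have hs : √(freq T k) ≠ 0 := (Real.sqrt_pos.2 hω).ne'
  have e : Real.sin (freq T k * (2 * (T - L) + L)) = Real.sin (freq T k * L) := by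
    have e1 : freq T k * (2 * (T - L) + L) =
        Real.pi - freq T k * L + k * (2 * Real.pi) := by
      linear_combination 2 * freq_mul_end hT k
    rw [e1, Real.sin_add_nat_mul_two_pi, Real.sin_pi_sub]
  rw [integral_cos_add_mul_cos_self hω.ne', e]
  field_simp
  ring

theorem inner_unitSeq_coupling_of_ne {T L : ℝ} (hT : 0 < T) (hL : 0 ≤ L) (hLT : L ≤ T) {k l : ℕ}
    (hkl : k ≠ l) :
    ⟪unitSeq k, coupling hT hL (unitSeq l)⟫_ℝ =
      2 / T * (√(freq T l) * √(freq T k)) * (1 + (-1) ^ l * (-1) ^ k) *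
        (Real.sin (freq T k * L) - Real.sin (freq T l * L)) / (freq T l ^ 2 - freq T k ^ 2) := by
  have hk := freq_pos hT k
  have hl := freq_pos hT l
  have hsk := Real.sq_sqrt hk.le
  have hsl := Real.sq_sqrt hl.le
  have hsk0 : √(freq T k) ≠ 0 := (Real.sqrt_pos.2 hk).ne'
  have hsl0 : √(freq T l) ≠ 0 := (Real.sqrt_pos.2 hl).ne'
  have hD : freq T k ^ 2 - freq T l ^ 2 = -(freq T l ^ 2 - freq T k ^ 2) := by ring
  rw [inner_unitSeq_coupling_eq_add, inner_unitSeq_advanceSeq hT hL hLT,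
    inner_unitSeq_advanceSeq hT hL hLT, integral_cos_add_mul_cos (freq_sq_ne hT hkl.symm),
    integral_cos_add_mul_cos (freq_sq_ne hT hkl), sub_add_cancel, cos_freq_end hT,
    cos_freq_end hT, sin_freq_end hT, sin_freq_end hT, cos_freq_mul_sub hT, cos_freq_mul_sub hT,
    hD, div_neg]
  have hne := sub_ne_zero.2 (freq_sq_ne hT hkl.symm)
  generalize freq T l ^ 2 - freq T k ^ 2 = D at hne
  -- the sines are generalized first, so that every remaining `ω` can be written as a square
  generalize Real.sin (freq T k * L) = B
  generalize Real.sin (freq T l * L) = A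
  generalize √(freq T k) = q at hsk hsk0 ⊢
  generalize √(freq T l) = p at hsl hsl0 ⊢
  rw [← hsk, ← hsl]
  field_simp
  ring

/-- The matrix of the coupling operator has the entries `b_{kℓ}`. -/
theorem inner_unitSeq_coupling {T L : ℝ} (hT : 0 < T) (hL : 0 ≤ L) (hLT : L ≤ T) (k l : ℕ) :
    ⟪unitSeq k, coupling hT hL (unitSeq l)⟫_ℝ = bCoeff T L k l := by
  unfold bCoeff
  split_ifs with hkl hdvd
  · subst hkl
    rw [inner_unitSeq_coupling_self hT hL hLT, freq_mul]
  · have hsign : (-1 : ℝ) ^ l * (-1) ^ k = 1 := by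
      rw [← pow_add]
      refine Even.neg_one_pow ?_
      obtain ⟨c, hc⟩ := hdvd
      exact ⟨(l + c).toNat, by omega⟩
    have hsin : Real.sin (freq T k * L) - Real.sin (freq T l * L) =
        2 * Real.sin ((k - l) * (Real.pi / 2) * (L / T)) *
          Real.cos ((k + l + 1) * (Real.pi / 2) * (L / T)) := by
      rw [Real.sin_sub_sin]
      congr 3
      · unfold freq; ring
      · unfold freq; ring
    have hneg : Real.sin (((l : ℝ) - k) * (Real.pi / 2) * (L / T)) =
        -Real.sin ((k - l) * (Real.pi / 2) * (L / T)) := by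
      rw [← Real.sin_neg]; congr 1; ring
    have hD : freq T l ^ 2 - freq T k ^ 2 =
        -(Real.pi ^ 2 / T ^ 2 * ((k + l + 1) * (k - l))) := by
      unfold freq; field_simp; ring
    have hpi := Real.pi_pos
    have hkl0 : (k : ℝ) - l ≠ 0 := sub_ne_zero.2 (by exact_mod_cast hkl)
    have hkl1 : (k : ℝ) + l + 1 ≠ 0 := by positivity
    have hr : √(Real.pi / (2 * T)) ^ 2 = Real.pi / (2 * T) := Real.sq_sqrt (by positivity)
    have hω : √(freq T l) * √(freq T k) =
        Real.pi / (2 * T) * (√(2 * (k : ℝ) + 1) * √(2 * (l : ℝ) + 1)) := by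
      rw [sqrt_freq hT k, sqrt_freq hT l]
      linear_combination √(2 * (k : ℝ) + 1) * √(2 * (l : ℝ) + 1) * hr
    rw [inner_unitSeq_coupling_of_ne hT hL hLT hkl, hsign, hsin, hneg, hD, hω]
    generalize √(2 * (k : ℝ) + 1) = x
    generalize √(2 * (l : ℝ) + 1) = y
    field_simp
    ring
  · have hsign : (-1 : ℝ) ^ l * (-1) ^ k = -1 := by
      rw [← pow_add]
      refine Odd.neg_one_pow ?_
      rw [← Nat.not_even_iff_odd]
      rintro ⟨c, hc⟩
      exact hdvd ⟨c - l, by omega⟩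
    rw [inner_unitSeq_coupling_of_ne hT hL hLT hkl, hsign]
    simp

theorem coupling_unitSeq_apply {T L : ℝ} (hT : 0 < T) (hL : 0 ≤ L) (hLT : L ≤ T) (k l : ℕ) :
    coupling hT hL (unitSeq l) k = bCoeff T L k l := by
  rw [← inner_unitSeq_coupling hT hL hLT, inner_unitSeq]

theorem hasSum_bCoeff_mul {T L : ℝ} (hT : 0 < T) (hL : 0 ≤ L) (hLT : L ≤ T) (l i : ℕ) :
    HasSum (fun k => bCoeff T L k l * bCoeff T L k i)
      ⟪coupling hT hL (unitSeq l), coupling hT hL (unitSeq i)⟫_ℝ := by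
  have h := lp.hasSum_inner (𝕜 := ℝ) (coupling hT hL (unitSeq l)) (coupling hT hL (unitSeq i))
  simp only [coupling_unitSeq_apply hT hL hLT] at h
  simpa [mul_comm] using h

theorem shift_eq_zero {T L : ℝ} (hTL : T ≤ L) (z : L2 T) : shift T (-L) z = 0 := by
  refine Lp.ext ?_
  filter_upwards [coeFn_shift_of_ae_eq (-L) (Filter.EventuallyEq.refl _ (z : ℝ → ℝ)),
    Lp.coeFn_zero ℝ 2 (volume.restrict (Ioo 0 T)), ae_restrict_mem measurableSet_Ioo]
    with t h1 h2 ht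
  rw [h1, h2, indicator_of_notMem, Pi.zero_apply]
  intro h
  linarith [h.2, ht.1]

theorem coupling_eq_zero {T L : ℝ} (hT : 0 < T) (hL : 0 ≤ L) (hTL : T ≤ L) :
    coupling hT hL = 0 := by
  have h : advanceSeq hT hL = 0 := by
    ext1 x
    have : advance T hL ((HHalf.coeff hT).symm x) = 0 := Subtype.ext (shift_eq_zero hTL _)
    rw [advanceSeq_apply, this, map_zero, zero_apply]
  rw [coupling, h, map_zero, add_zero]

/-- `C_m` is a Gram matrix of columns of the coupling operator; for `T ≤ L` both vanish. -/
theorem cMatrix_apply {T L : ℝ} (hT : 0 < T) (hL : 0 ≤ L) (m : ℕ) (l i : Fin (m + 1)) :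
    cMatrix T L m l i = ⟪coupling hT hL (unitSeq l), coupling hT hL (unitSeq i)⟫_ℝ := by
  unfold cMatrix
  split_ifs with h
  · simp [coupling_eq_zero hT hL h]
  · exact (hasSum_bCoeff_mul hT hL (not_le.1 h).le l i).tsum_eq

/-! ### The maximal eigenvalues of the finite sections -/

/-- The finitely supported sequence with the given first entries. -/
def ofFin (m : ℕ) (ξ : Fin (m + 1) → ℝ) : SeqL2 := ∑ l, ξ l • unitSeq l

theorem norm_ofFin_sq (m : ℕ) (ξ : Fin (m + 1) → ℝ) : ‖ofFin m ξ‖ ^ 2 = ∑ l, ξ l ^ 2 := by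
  have ho : ∀ i j : Fin (m + 1), ⟪unitSeq i, unitSeq j⟫_ℝ = if i = j then 1 else 0 := by
    intro i j
    rw [inner_unitSeq, lp.single_apply]
    simp [Pi.single_apply, Fin.ext_iff]
  rw [← real_inner_self_eq_norm_sq, ofFin, sum_inner]
  refine Finset.sum_congr rfl fun i _ => ?_
  rw [inner_sum]
  simp only [real_inner_smul_left, real_inner_smul_right, ho]
  simp [sq]

theorem cMatrix_quadratic {T L : ℝ} (hT : 0 < T) (hL : 0 ≤ L) (m : ℕ) (ξ : Fin (m + 1) → ℝ) :
    ξ ⬝ᵥ (cMatrix T L m).mulVec ξ = ‖coupling hT hL (ofFin m ξ)‖ ^ 2 := by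
  rw [← real_inner_self_eq_norm_sq, ofFin, map_sum, sum_inner]
  simp only [dotProduct, Matrix.mulVec]
  refine Finset.sum_congr rfl fun i _ => ?_
  rw [inner_sum, Finset.mul_sum]
  refine Finset.sum_congr rfl fun j _ => ?_
  rw [cMatrix_apply hT hL, map_smul, map_smul, real_inner_smul_left, real_inner_smul_right]
  ring

/-- The maximal eigenvalue of a Hermitian matrix bounds its quadratic form. -/
theorem dotProduct_mulVec_le_iSup_eigenvalues {n : Type*} [Fintype n] [DecidableEq n]
    {A : Matrix n n ℝ} (hA : A.IsHermitian) (ξ : n → ℝ) :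
    ξ ⬝ᵥ A.mulVec ξ ≤ (⨆ i, hA.eigenvalues i) * (ξ ⬝ᵥ ξ) := by
  set b := hA.eigenvectorBasis with hb
  set x : EuclideanSpace ℝ n := WithLp.toLp 2 ξ with hx
  have h1 (y z : n → ℝ) : y ⬝ᵥ z = ∑ i, ⟪b i, WithLp.toLp 2 y⟫_ℝ * ⟪b i, WithLp.toLp 2 z⟫_ℝ := by
    have h := b.sum_inner_mul_inner (WithLp.toLp 2 y) (WithLp.toLp 2 z)
    simp only [real_inner_comm (b _) (WithLp.toLp 2 y)] at h
    rw [h]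
    simp [PiLp.inner_apply, dotProduct, mul_comm]
  have h2 (i : n) : ⟪b i, WithLp.toLp 2 (A.mulVec ξ)⟫_ℝ = hA.eigenvalues i * ⟪b i, x⟫_ℝ := by
    have e (u v : EuclideanSpace ℝ n) : ⟪u, v⟫_ℝ = u.ofLp ⬝ᵥ v.ofLp := by
      simp [PiLp.inner_apply, dotProduct, mul_comm]
    have hs : A.transpose = A := (Matrix.conjTranspose_eq_transpose_of_trivial A).symm.trans hA
    rw [e, e, Matrix.dotProduct_mulVec, ← Matrix.mulVec_transpose, hs,
      hA.mulVec_eigenvectorBasis, smul_dotProduct, smul_eq_mul]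
  rw [h1, h1, Finset.mul_sum]
  refine Finset.sum_le_sum fun i _ => ?_
  rw [h2]
  have := le_ciSup (Set.finite_range hA.eigenvalues).bddAbove i
  nlinarith [mul_self_nonneg ⟪b i, x⟫_ℝ]

theorem norm_coupling_ofFin_sq_le {T L : ℝ} (hT : 0 < T) (hL : 0 ≤ L) (m : ℕ)
    (ξ : Fin (m + 1) → ℝ) :
    ‖coupling hT hL (ofFin m ξ)‖ ^ 2 ≤ lambdaMax T L m * ‖ofFin m ξ‖ ^ 2 := by
  rw [← cMatrix_quadratic, norm_ofFin_sq]
  refine (dotProduct_mulVec_le_iSup_eigenvalues (cMatrix_isHermitian T L m) ξ).trans (le_of_eq ?_)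
  simp [lambdaMax, dotProduct, sq]

theorem lambdaMax_le {T L : ℝ} (hT : 0 < T) (hL : 0 ≤ L) (m : ℕ) :
    lambdaMax T L m ≤ ‖coupling hT hL‖ ^ 2 := by
  refine ciSup_le fun i => ?_
  have hA := cMatrix_isHermitian T L m
  have h1 : hA.eigenvalues i = ‖coupling hT hL (ofFin m (hA.eigenvectorBasis i).ofLp)‖ ^ 2 := by
    rw [hA.eigenvalues_eq, ← cMatrix_quadratic]
    rfl
  have h2 : ‖ofFin m (hA.eigenvectorBasis i).ofLp‖ ^ 2 = 1 := by
    have := hA.eigenvectorBasis.orthonormal.1 i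
    have h := EuclideanSpace.norm_sq_eq (hA.eigenvectorBasis i)
    rw [this, one_pow] at h
    rw [norm_ofFin_sq, h]
    simp
  rw [h1]
  have h3 := (coupling hT hL).le_opNorm (ofFin m (hA.eigenvectorBasis i).ofLp)
  refine (pow_le_pow_left₀ (norm_nonneg _) h3 2).trans (le_of_eq ?_)
  rw [mul_pow, h2, mul_one]

theorem sqrt_lambdaMax_le {T L : ℝ} (hT : 0 < T) (hL : 0 ≤ L) (m : ℕ) :
    √(lambdaMax T L m) ≤ 2 := by
  refine Real.sqrt_le_iff.2 ⟨by norm_num, (lambdaMax_le hT hL m).trans ?_⟩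
  exact pow_le_pow_left₀ (norm_nonneg _) (norm_coupling_le hT hL) 2

theorem bddAbove_sqrt_lambdaMax {T L : ℝ} (hT : 0 < T) (hL : 0 ≤ L) :
    BddAbove (range fun m : ℕ => √(lambdaMax T L m)) :=
  ⟨2, by rintro _ ⟨m, rfl⟩; exact sqrt_lambdaMax_le hT hL m⟩

/-- Truncations are dense in `ℓ²`, so the finite sections control the norm of the coupling
operator. -/
theorem norm_coupling_apply_le {T L : ℝ} (hT : 0 < T) (hL : 0 ≤ L) (x : SeqL2) :
    ‖coupling hT hL x‖ ≤ (⨆ m : ℕ, √(lambdaMax T L m)) * ‖x‖ := by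
  have h1 : Filter.Tendsto (fun m : ℕ => ofFin m fun l => x l) Filter.atTop (nhds x) := by
    have h := (lp.hasSum_single (by norm_num) x).tendsto_sum_nat.comp
      (Filter.tendsto_add_atTop_nat 1)
    refine h.congr fun m => ?_
    simp only [Function.comp, ofFin]
    rw [Finset.sum_range]
    refine Finset.sum_congr rfl fun l _ => ?_
    rw [← lp.single_smul, smul_eq_mul, mul_one]
  refine le_of_tendsto_of_tendsto' (((coupling hT hL).continuous.tendsto x).comp h1).norm
    (h1.norm.const_mul _) fun m => ?_
  have h2 := norm_coupling_ofFin_sq_le hT hL m fun l => x l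
  have h3 : ‖coupling hT hL (ofFin m fun l => x l)‖ ≤
      √(lambdaMax T L m) * ‖ofFin m fun l => x l‖ := by
    have h4 := Real.sqrt_le_sqrt h2
    rwa [Real.sqrt_sq (norm_nonneg _), Real.sqrt_mul' _ (sq_nonneg _),
      Real.sqrt_sq (norm_nonneg _)] at h4
  refine h3.trans ?_
  gcongr
  exact le_ciSup (bddAbove_sqrt_lambdaMax hT hL) m

/-! ### Functionals on the boundary `Σ` -/

theorem apply_toLp {T : ℝ} (w : StrongDual ℝ (HHalfSigma T)) (f g : HHalf T) :
    w (WithLp.toLp 2 (f, g)) = dualFst w f + dualSnd w g := by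
  have e : (WithLp.toLp 2 (f, g) : HHalfSigma T) =
      WithLp.toLp 2 (f, 0) + WithLp.toLp 2 (0, g) := by
    rw [← WithLp.toLp_add, Prod.mk_add_mk, add_zero, zero_add]
  rw [e, map_add]
  rfl

/-- With the Riesz representatives of its components, a functional on the product has at most the
Euclidean norm of the pair. -/
theorem norm_sq_dual_le {T : ℝ} (hT : 0 < T) (w : StrongDual ℝ (HHalfSigma T)) :
    ‖w‖ ^ 2 ≤ ‖riesz hT (dualFst w)‖ ^ 2 + ‖riesz hT (dualSnd w)‖ ^ 2 := by
  set x := riesz hT (dualFst w) with hx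
  set y := riesz hT (dualSnd w) with hy
  rw [← Real.sqrt_le_sqrt_iff (by positivity), Real.sqrt_sq (norm_nonneg _)]
  refine ContinuousLinearMap.opNorm_le_bound _ (Real.sqrt_nonneg _) fun z => ?_
  have hz : w z = ⟪x, HHalf.coeff hT z.fst⟫_ℝ + ⟪y, HHalf.coeff hT z.snd⟫_ℝ := by
    rw [← apply_eq_inner_riesz, ← apply_eq_inner_riesz, ← apply_toLp]
    rfl
  have h1 := abs_real_inner_le_norm x (HHalf.coeff hT z.fst)
  have h2 := abs_real_inner_le_norm y (HHalf.coeff hT z.snd)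
  rw [LinearIsometryEquiv.norm_map] at h1 h2
  rw [hz, WithLp.prod_norm_eq_of_L2, ← Real.sqrt_mul (by positivity), Real.norm_eq_abs]
  refine (abs_add_le _ _).trans ((add_le_add h1 h2).trans (Real.le_sqrt_of_sq_le ?_))
  nlinarith [sq_nonneg (‖x‖ * ‖z.snd‖ - ‖y‖ * ‖z.fst‖)]

/-! ### The single layer operator -/

theorem singleLayerZero_eq {T L : ℝ} (hL : 0 ≤ L) (w : StrongDual ℝ (HHalfSigma T)) :
    singleLayerZero T L w =
      dtInv T ((1 / 2 : ℝ) • (dualFst w + dualSnd w ∘L advance T hL)) := by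
  rw [singleLayerZero, shift_dtInv hL, dtInv_smul, dtInv_add]

theorem singleLayerEnd_eq {T L : ℝ} (hL : 0 ≤ L) (w : StrongDual ℝ (HHalfSigma T)) :
    singleLayerEnd T L w =
      dtInv T ((1 / 2 : ℝ) • (dualFst w ∘L advance T hL + dualSnd w)) := by
  rw [singleLayerEnd, shift_dtInv hL, dtInv_smul, dtInv_add]

theorem riesz_comp_advance {T L : ℝ} (hT : 0 < T) (hL : 0 ≤ L) (φ : StrongDual ℝ (HHalf T)) :
    riesz hT (φ ∘L advance T hL) =
      ContinuousLinearMap.adjoint (advanceSeq hT hL) (riesz hT φ) := by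
  refine ext_inner_right ℝ fun x => ?_
  rw [inner_riesz, ContinuousLinearMap.adjoint_inner_left, inner_riesz, advanceSeq_apply,
    LinearIsometryEquiv.symm_apply_apply]
  rfl

theorem hilbertT_dtInv_mem {T : ℝ} (hT : 0 < T) (φ : StrongDual ℝ (HHalf T)) :
    hilbertT T (dtInv T φ) ∈ hHalfSubmodule T := by
  rw [hilbertT_dtInv hT]
  exact HHalf.memLp _

theorem apply_mk_hilbertT {T : ℝ} (hT : 0 < T) (φ ψ : StrongDual ℝ (HHalf T)) {u : L2 T}
    (hu : u = dtInv T ψ) (h : hilbertT T u ∈ hHalfSubmodule T) :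
    φ (HHalf.mk (hilbertT T u) h) = ⟪riesz hT φ, riesz hT ψ⟫_ℝ := by
  subst hu
  have e : HHalf.mk (hilbertT T (dtInv T ψ)) h = (HHalf.coeff hT).symm (riesz hT ψ) :=
    Subtype.ext (hilbertT_dtInv hT ψ)
  rw [e, inner_riesz]

/-- The bilinear form of the single layer operator in the Riesz representatives `x` and `y` of the
two components of `w`: the identity plus the coupling operator, up to the factor `1/2`. -/
theorem apply_hilbertT_singleLayer {T L : ℝ} (hT : 0 < T) (hL : 0 ≤ L)
    (w : StrongDual ℝ (HHalfSigma T)) (h₀ : hilbertT T (singleLayerZero T L w) ∈ hHalfSubmodule T)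
    (h_L : hilbertT T (singleLayerEnd T L w) ∈ hHalfSubmodule T) :
    w (WithLp.toLp 2 (HHalf.mk _ h₀, HHalf.mk _ h_L)) =
      1 / 2 * (‖riesz hT (dualFst w)‖ ^ 2 + ‖riesz hT (dualSnd w)‖ ^ 2 +
        ⟪riesz hT (dualFst w), coupling hT hL (riesz hT (dualSnd w))⟫_ℝ) := by
  rw [apply_toLp, apply_mk_hilbertT hT _ _ (singleLayerZero_eq hL w),
    apply_mk_hilbertT hT _ _ (singleLayerEnd_eq hL w), riesz_smul, riesz_smul, riesz_add, riesz_add,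
    riesz_comp_advance, riesz_comp_advance]
  generalize riesz hT (dualFst w) = x
  generalize riesz hT (dualSnd w) = y
  rw [coupling, add_apply, inner_add_right, real_inner_smul_right, real_inner_smul_right,
    inner_add_right, inner_add_right, real_inner_self_eq_norm_sq, real_inner_self_eq_norm_sq,
    ContinuousLinearMap.adjoint_inner_right _ y x, real_inner_comm x (advanceSeq hT hL y)]
  ring

theorem le_apply_hilbertT_singleLayer {T L : ℝ} (hT : 0 < T) (hL : 0 ≤ L)
    (w : StrongDual ℝ (HHalfSigma T)) (h₀ : hilbertT T (singleLayerZero T L w) ∈ hHalfSubmodule T)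
    (h_L : hilbertT T (singleLayerEnd T L w) ∈ hHalfSubmodule T) :
    1 / 2 * (1 - 1 / 2 * ⨆ m : ℕ, √(lambdaMax T L m)) * ‖w‖ ^ 2 ≤
      w (WithLp.toLp 2 (HHalf.mk _ h₀, HHalf.mk _ h_L)) := by
  rw [apply_hilbertT_singleLayer hT hL w h₀ h_L]
  have hw := norm_sq_dual_le hT w
  set x := riesz hT (dualFst w)
  set y := riesz hT (dualSnd w)
  set β := ⨆ m : ℕ, √(lambdaMax T L m)
  have hβ0 : 0 ≤ β := Real.iSup_nonneg fun _ => Real.sqrt_nonneg _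
  have hβ2 : β ≤ 2 := ciSup_le fun m => sqrt_lambdaMax_le hT hL m
  have h1 : -(β * (‖x‖ * ‖y‖)) ≤ ⟪x, coupling hT hL y⟫_ℝ := by
    have h2 := (abs_le.1 (abs_real_inner_le_norm x (coupling hT hL y))).1
    have h3 := mul_le_mul_of_nonneg_left (norm_coupling_apply_le hT hL y) (norm_nonneg x)
    linarith
  have h4 : β * (‖x‖ * ‖y‖) ≤ β * (1 / 2 * (‖x‖ ^ 2 + ‖y‖ ^ 2)) :=
    mul_le_mul_of_nonneg_left (by nlinarith [sq_nonneg (‖x‖ - ‖y‖)]) hβ0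
  -- the constant is nonnegative because `β ≤ 2`, so an upper bound for `‖w‖` suffices
  have h5 := mul_le_mul_of_nonneg_left hw (by linarith : 0 ≤ 1 / 2 * (1 - 1 / 2 * β))
  linarith

theorem lambdaMax_eq_zero {T L : ℝ} (hTL : T ≤ L) (m : ℕ) : lambdaMax T L m = 0 := by
  have h : cMatrix T L m = 0 := if_pos hTL
  have h0 : (cMatrix_isHermitian T L m).eigenvalues = 0 :=
    (cMatrix_isHermitian T L m).eigenvalues_eq_zero_iff.2 h
  simp [lambdaMax, h0]

end WaveBIE

end

theorem lemma4p1 (T L : ℝ) (hT : 0 < T) (hL : 0 < L) :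
    (∀ m : ℕ, (WaveBIE.cMatrix T L m).IsSymm) ∧
    (T ≤ L → ∀ m : ℕ, WaveBIE.lambdaMax T L m = 0) ∧
    (L < T → ∀ l i : ℕ, Summable fun k : ℕ => WaveBIE.bCoeff T L k l * WaveBIE.bCoeff T L k i) ∧
    BddAbove (Set.range fun m : ℕ => √(WaveBIE.lambdaMax T L m)) ∧
    ∀ w : StrongDual ℝ (WaveBIE.HHalfSigma T),
      ∃ (h₀ : WaveBIE.hilbertT T (WaveBIE.singleLayerZero T L w) ∈ WaveBIE.hHalfSubmodule T)
        (h_L : WaveBIE.hilbertT T (WaveBIE.singleLayerEnd T L w) ∈ WaveBIE.hHalfSubmodule T),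
        1 / 2 * (1 - 1 / 2 * ⨆ m : ℕ, √(WaveBIE.lambdaMax T L m)) * ‖w‖ ^ 2 ≤
          w (WithLp.toLp 2 (WaveBIE.HHalf.mk _ h₀, WaveBIE.HHalf.mk _ h_L)) := by
  refine ⟨fun m => ?_, fun h => WaveBIE.lambdaMax_eq_zero h,
    fun h l i => (WaveBIE.hasSum_bCoeff_mul hT hL.le h.le l i).summable,
    WaveBIE.bddAbove_sqrt_lambdaMax hT hL.le, fun w => ⟨?_, ?_, ?_⟩⟩
  · exact (Matrix.conjTranspose_eq_transpose_of_trivial _).symm.trans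
      (WaveBIE.cMatrix_isHermitian T L m)
  · rw [WaveBIE.singleLayerZero_eq hL.le]
    exact WaveBIE.hilbertT_dtInv_mem hT _
  · rw [WaveBIE.singleLayerEnd_eq hL.le]
    exact WaveBIE.hilbertT_dtInv_mem hT _
  · exact WaveBIE.le_apply_hilbertT_singleLayer hT hL.le w _ _
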